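/- Let $r>0$, $\lambda>0$, $x^*>0$, $\alpha>\lambda/r$ and $x\ge x^*$. Let $0=T_0<T_1<T_2<\cdots$ be the event times of a Poisson process with intensity $\lambda$, and let $(Z_i)_{i\ge1}$ be i.i.d. $\mathrm{Beta}(\alpha,1)$ random variables (distribution function $z^\alpha$ on $[0,1]$), independent of the Poisson process. Define the household capital process by $X_0=x$ and, for $i\ge1$, $$X_t=\begin{cases}(X_{T_{i-1}}-x^*)e^{r(t-T_{i-1})}+x^* & \text{if } X_{T_{i-1}}>x^*,\\ X_{T_{i-1}} & \text{otherwise,}\end{cases}\qquad T_{i-1}\le t<T_i,$$ $$X_{T_i}=\begin{cases}\left[(X_{T_{i-1}}-x^*)e^{r(T_i-T_{i-1})}+x^*\right]Z_i & \text{if } X_{T_{i-1}}>x^*,\\ X_{T_{i-1}}Z_i & \text{otherwise.}\end{cases}$$ Let $\tau_x=\inf\{t\ge0:X_t<x^*\}\in[0,\infty]$ be the trapping time and $m_\delta(x)=\mathbb E[e^{-\delta\tau_x}\mathbf 1_{\{\tau_x<\infty\}}]$, $\delta\ge0$, its Laplace transform. Write ${}_2F_1(a,b;c;z)=\sum_{n\ge0}\frac{(a)_n(b)_n}{(c)_n}\frac{z^n}{n!}$,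 write ${}_2F_1^{(a)},{}_2F_1^{(b)},{}_2F_1^{(c)}$ for its partial derivatives with respect to its first, second and third parameter, and put $y=x/x^*$. Then $\tau_x\mathbf 1_{\{\tau_x<\infty\}}$ is integrable; the function $\delta\mapsto m_\delta(x)$ on $[0,\infty)$ is (right-)differentiable at $0$; at the parameters $\left(\alpha-\frac\lambda r,\,1-\frac\lambda r;\,1+\alpha-\frac\lambda r\right)$ the series of ${}_2F_1$ converges and the three parameter derivatives exist, both for the argument $y^{-1}$ and for the argument $1$; and $$\mathbb E[\tau_x;\tau_x<\infty]:=\mathbb E[\tau_x\mathbf 1_{\{\tau_x<\infty\}}]=-\left.\frac{d}{d\delta}m_\delta(x)\right|_{\delta=0}$$ is equal to $$\frac{\Gamma(\alpha)\,y^{\frac\lambda r-\alpha}}{r(\alpha r-\lambda)\,\Gamma\left(\frac\lambda r\right)^2\Gamma\left(\alpha-\frac\lambda r+1\right)^2}\Big[\Gamma(\alpha)\,F(y^{-1})\,D(1)+\tfrac1\lambda\,\Gamma\left(\tfrac\lambda r\right)\Gamma\left(1+\alpha-\tfrac\lambda r\right)\Big(F(y^{-1})\big(r(\alpha r-\lambda)+\lambda^2\ln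 y\big)-\lambda\,D(y^{-1})\Big)\Big],$$ where $F(z)={}_2F_1\left(1-\frac\lambda r,\alpha-\frac\lambda r;1+\alpha-\frac\lambda r;z\right)$ and $$D(z)=(\alpha r+\lambda)\,{}_2F_1^{(c)}(z)+\lambda\left({}_2F_1^{(a)}(z)+{}_2F_1^{(b)}(z)\right),$$ with the three parameter derivatives taken at $\left(\alpha-\frac\lambda r,\,1-\frac\lambda r;\,1+\alpha-\frac\lambda r;\,z\right)$. -/

import Mathlib

open MeasureTheory ProbabilityTheory

noncomputable section

namespace Household

/-- The loss data of the model on a probability space `(Ω, P)`.  `T n` is the time of the `n`-th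
capital loss (with `T 0 = 0`), that is, the `n`-th event time of a Poisson process with intensity
`lam`: the inter-arrival times are i.i.d. exponential with rate `lam`.  `Z n` is the proportion of
capital remaining after the `n`-th loss, for `n ≥ 1` (`Z 0` is never used): the proportions are i.i.d. `Beta(α, 1)` and independent of the loss times. -/
structure IsLossModel {Ω : Type*} [MeasurableSpace Ω] (P : Measure Ω) (lam α : ℝ)
    (T Z : ℕ → Ω → ℝ) : Prop where
  measurable_T : ∀ n, Measurable (T n)
  measurable_Z : ∀ n, Measurable (Z n)
  T_zero : ∀ ω, T 0 ω = 0
  law_interarrival : ∀ n, P.map (fun ω => T (n + 1) ω - T n ω) = expMeasure lam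
  law_Z : ∀ n, P.map (Z (n + 1)) = betaMeasure α 1
  /-- All inter-arrival times and all remaining proportions are mutually independent. -/
  indep : iIndepFun
    (Sum.elim (fun n ω => T (n + 1) ω - T n ω) (fun n => Z (n + 1)) : ℕ ⊕ ℕ → Ω → ℝ) P

/-- Loss-free evolution over a duration `s` from capital `u`: exponential growth at rate `r` of the
surplus over the critical capital `xs` if `u > xs`, constant capital otherwise. -/
def growth (r xs s u : ℝ) : ℝ :=
  if xs < u then (u - xs) * Real.exp (r * s) + xs else u

/-- The capital `X_{T_n}` right after the `n`-th loss, for a sequence of loss times `T` and of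
remaining proportions `Z`, with initial capital `x`. -/
def capitalAtLoss (r xs x : ℝ) (T Z : ℕ → ℝ) : ℕ → ℝ
  | 0 => x
  | n + 1 => growth r xs (T (n + 1) - T n) (capitalAtLoss r xs x T Z n) * Z (n + 1)

/-- The number `N_t` of losses in `(0, t]`. -/
def lossCount (T : ℕ → ℝ) (t : ℝ) : ℕ := {n : ℕ | 1 ≤ n ∧ T n ≤ t}.ncard

/-- The capital `X_t`: if `T_n ≤ t < T_{n+1}`, it is the loss-free evolution over the duration
`t - T_n` from `X_{T_n}`. -/
def capital (r xs x : ℝ) (T Z : ℕ → ℝ) (t : ℝ) : ℝ :=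
  growth r xs (t - T (lossCount T t)) (capitalAtLoss r xs x T Z (lossCount T t))

/-- The trapping time `τ_x = inf {t ≥ 0 : X_t < xs}` in `[0, ∞]` (equal to `∞` if there is no such
`t`). -/
def trappingTime (r xs x : ℝ) (T Z : ℕ → ℝ) : ENNReal :=
  sInf (ENNReal.ofReal '' {t : ℝ | 0 ≤ t ∧ capital r xs x T Z t < xs})

/-- The random variable `τ_x 1_{τ_x < ∞}`. -/
def trappingTimeOnFinite {Ω : Type*} (r xs x : ℝ) (T Z : ℕ → Ω → ℝ) : Ω → ℝ :=
  {ω | trappingTime r xs x (fun n => T n ω) (fun n => Z n ω) < ⊤}.indicator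
    (fun ω => (trappingTime r xs x (fun n => T n ω) (fun n => Z n ω)).toReal)

/-- `m_δ(x) = E[exp(-δ τ_x) 1_{τ_x < ∞}]`, the Laplace transform of the trapping time. -/
def trappingLaplace {Ω : Type*} [MeasurableSpace Ω] (P : Measure Ω) (r xs x : ℝ)
    (T Z : ℕ → Ω → ℝ) (δ : ℝ) : ℝ :=
  ∫ ω, {ω | trappingTime r xs x (fun n => T n ω) (fun n => Z n ω) < ⊤}.indicator
    (fun ω => Real.exp
      (-δ * (trappingTime r xs x (fun n => T n ω) (fun n => Z n ω)).toReal)) ω ∂P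

/-- Gauss's hypergeometric function with real parameters and argument. -/
abbrev F (a b c z : ℝ) : ℝ := ordinaryHypergeometric a b c z

/-- The derivative of `₂F₁(a, b; c; z)` with respect to its first parameter. -/
def Fa (a b c z : ℝ) : ℝ := deriv (fun s => F s b c z) a

/-- The derivative of `₂F₁(a, b; c; z)` with respect to its second parameter. -/
def Fb (a b c z : ℝ) : ℝ := deriv (fun s => F a s c z) b

/-- The derivative of `₂F₁(a, b; c; z)` with respect to its third parameter. -/
def Fc (a b c z : ℝ) : ℝ := deriv (fun s => F a b s z) c

/-- The series of `₂F₁(a, b; c; z)` converges, and the function is differentiable with respect to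
each of its three parameters. -/
def FRegularAt (a b c z : ℝ) : Prop :=
  Summable (fun n : ℕ => ordinaryHypergeometricCoefficient a b c n * z ^ n) ∧
  DifferentiableAt ℝ (fun s => F s b c z) a ∧
  DifferentiableAt ℝ (fun s => F a s c z) b ∧
  DifferentiableAt ℝ (fun s => F a b s z) c

end Household

end

/-! For q > 0 let H(y) be the Laplace transform at q started from capital y·xs, set equal to 1 below
y = 1, and let G(y) be the mean of H(yZ). Conditioning on the first loss gives the renewal equation
H(y) = E[exp(-qS) G((y - 1)exp(rS) + 1)] with S exponential of rate l. Because the densities are an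
exponential and a power, it follows from two first-order equations: (l + q)H - r(y - 1)H' = lG and
yG' = α(H - G), with (l + q)H(1) = l and G(1) = 1.

Put H = C ∑ f_n y^(-k-n). The first equation says that lG has the coefficients `averageCoeff`,
multiplied by C. The second then asks for (α - k - n) g_n = α l f_n, where g is `averageCoeff` of f.
Its case n = 0 is the quadratic equation for k, and the other cases are the hypergeometric recursion
for a = k, b = k + 1 - α, c = 1 + 2k - α + (l + q)/r. Here c - a - b = (l + q)/r > 0, so everything
converges absolutely up to y = 1, and H and G are bounded and continuous there. This is
`laplaceSolution_spec`.

Conversely, a bounded solution of the renewal equation that equals 1 below the critical level must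
be the Laplace transform: following it through n losses leaves an error of at most (1 + B) E[exp(-q
T_n)] = (1 + B)(l/(l + q))^n, which tends to 0 (`integral_discount_trappingTime`). This needs q > 0,
so the point q = 0 is reached only as a limit.

The explicit formula is differentiable at q = 0. Near the parameters in question the hypergeometric
series and its parameter derivatives are dominated by one summable sequence, also at argument 1, so
the chain rule applies along the curve of parameters. At q = 0 one has c = a + 1, and the
normalising value at 1 is given by Gauss's theorem. Finally, Fatou's lemma and then dominated
convergence turn differentiability of the formula into integrability of the trapping time on its
finiteness event and into the value of its mean (`integrable_toReal_of_laplace`). -/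

namespace Household

open Filter Topology

/-! ### Hypergeometric series: convergence and parameter derivatives up to the unit circle -/

/-- A weak form of Raabe's test. -/
theorem summable_of_raabe {u : ℕ → ℝ} {η : ℝ} (hη : 0 < η) (hu : ∀ n, 0 ≤ u n)
    (h : ∀ᶠ n : ℕ in atTop, ((n : ℝ) + 1) * u (n + 1) ≤ (n - η) * u n) : Summable u := by
  obtain ⟨N, hN⟩ := eventually_atTop.1 h
  rw [← summable_nat_add_iff N]
  refine summable_of_sum_range_le (c := N * u N / η) (fun n => hu _) fun n => ?_
  -- The hypothesis says that n·u n drops by at least η·u n at each step, so the sum telescopes.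
  have key : ∀ n : ℕ, η * ∑ i ∈ Finset.range n, u (i + N) ≤
      N * u N - ((n + N : ℕ) : ℝ) * u (n + N) := by
    intro n
    induction n with
    | zero => simp
    | succ n ih =>
      have h1 := hN (n + N) (by omega)
      rw [Finset.sum_range_succ, mul_add, show n + 1 + N = n + N + 1 by ring]
      push_cast at h1 ih ⊢
      linarith
  rw [le_div_iff₀ hη]
  have h2 : 0 ≤ ((n + N : ℕ) : ℝ) * u (n + N) := mul_nonneg (Nat.cast_nonneg _) (hu _)
  linarith [key n]

/-- The `n`-th term of a series that dominates the hypergeometric series, and its partial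
derivatives with respect to the parameters, near the parameters `a`, `b`, `c`. -/
noncomputable def majorant (a b c e : ℝ) (n : ℕ) : ℝ :=
  ∏ j ∈ Finset.range n,
    ((|a + j| + 2 * e) * (|b + j| + 2 * e) * (c + j - 2 * e)⁻¹ * (1 + j : ℝ)⁻¹)

theorem majorant_nonneg {a b c e : ℝ} (he : 0 < e) (hc : 2 * e < c) (n : ℕ) :
    0 ≤ majorant a b c e n := by
  refine Finset.prod_nonneg fun j _ => ?_
  have : 0 < c + j - 2 * e := by have : (0 : ℝ) ≤ j := j.cast_nonneg; linarith
  positivity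

/-- The shifts by 2e in the two numerators and in the denominator use 6e of the excess c - a - b,
and Raabe's test with η = e/2 uses e/2. The remaining e/2, multiplied by n, eventually absorbs the
constant terms. -/
theorem summable_majorant {a b c e : ℝ} (he : 0 < e) (hc : 2 * e < c)
    (hs : 7 * e ≤ c - a - b) : Summable (majorant a b c e) := by
  refine summable_of_raabe (η := e / 2) (by positivity) (majorant_nonneg he hc) ?_
  have h1 : ∀ᶠ n : ℕ in atTop, 0 ≤ a + n :=
    (tendsto_atTop_add_const_left _ a tendsto_natCast_atTop_atTop).eventually_ge_atTop 0
  have h2 : ∀ᶠ n : ℕ in atTop, 0 ≤ b + n :=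
    (tendsto_atTop_add_const_left _ b tendsto_natCast_atTop_atTop).eventually_ge_atTop 0
  have h3 : ∀ᶠ n : ℕ in atTop, (a + 2 * e) * (b + 2 * e) + e / 2 * (c - 2 * e) ≤ e / 2 * n :=
    (tendsto_natCast_atTop_atTop.const_mul_atTop (by positivity : 0 < e / 2)).eventually_ge_atTop _
  filter_upwards [h1, h2, h3] with n h1 h2 h3
  have hn : (0 : ℝ) ≤ n := n.cast_nonneg
  have hcn : 0 < c + n - 2 * e := by linarith
  have hM := majorant_nonneg (a := a) (b := b) he hc n
  rw [majorant, Finset.prod_range_succ, ← majorant, abs_of_nonneg h1, abs_of_nonneg h2]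
  have : (n + 1 : ℝ) * (majorant a b c e n * ((a + n + 2 * e) * (b + n + 2 * e) *
      (c + n - 2 * e)⁻¹ * (1 + n : ℝ)⁻¹)) =
      ((a + n + 2 * e) * (b + n + 2 * e) * (c + n - 2 * e)⁻¹) * majorant a b c e n := by
    field_simp
    ring
  rw [this]
  refine mul_le_mul_of_nonneg_right ?_ hM
  rw [mul_inv_le_iff₀ hcn]
  nlinarith [mul_nonneg hn (by linarith : 0 ≤ c - a - b - 7 * e), mul_nonneg hn he.le]

/-- The Pochhammer symbol and its derivative, near `a`. -/
theorem ascPochhammer_bound {a e x : ℝ} (he : 0 < e) (hx : |x - a| ≤ e) (n : ℕ) :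
    |(ascPochhammer ℝ n).eval x| + e * |(ascPochhammer ℝ n).derivative.eval x| ≤
      ∏ j ∈ Finset.range n, (|a + j| + 2 * e) := by
  induction n with
  | zero => simp
  | succ n ih =>
    rw [Finset.prod_range_succ, ascPochhammer_succ_right]
    simp only [Polynomial.derivative_mul, Polynomial.eval_mul, Polynomial.eval_add,
      Polynomial.eval_X, Polynomial.eval_natCast, Polynomial.derivative_add,
      Polynomial.derivative_X, Polynomial.derivative_natCast, add_zero, mul_one]
    set p := (ascPochhammer ℝ n).eval x
    set p' := (ascPochhammer ℝ n).derivative.eval x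
    have h1 : |x + n| ≤ |a + n| + e := by
      calc |x + n| = |(a + n) + (x - a)| := by ring_nf
        _ ≤ _ := (abs_add_le _ _).trans (by linarith)
    calc |p * (x + n)| + e * |p' * (x + n) + p|
        ≤ |p| * |x + n| + e * (|p'| * |x + n| + |p|) := by
          rw [abs_mul]
          gcongr
          exact (abs_add_le _ _).trans_eq (by rw [abs_mul])
      _ ≤ (|p| + e * |p'|) * |x + n| + e * (|p| + e * |p'|) := by
          nlinarith [abs_nonneg p', mul_nonneg he.le (abs_nonneg p')]
      _ = (|p| + e * |p'|) * (|x + n| + e) := by ring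
      _ ≤ _ := by
          have : |x + n| + e ≤ |a + n| + 2 * e := by linarith
          exact mul_le_mul ih this (by positivity) (Finset.prod_nonneg fun j _ => by positivity)

/-- By the product rule the weighted size |f| + e|f'| is submultiplicative, so it can be bounded
factor by factor. A factor 1/t contributes 1/t + e/t², which is at most 1/(t - e). -/
theorem inv_ascPochhammer_bound {c e x : ℝ} (he : 0 < e) (hc : 2 * e < c) (hx : |x - c| ≤ e)
    (n : ℕ) : 0 < (ascPochhammer ℝ n).eval x ∧
    |((ascPochhammer ℝ n).eval x)⁻¹| +
        e * |-(ascPochhammer ℝ n).derivative.eval x / (ascPochhammer ℝ n).eval x ^ 2| ≤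
      ∏ j ∈ Finset.range n, (c + j - 2 * e)⁻¹ := by
  have hx' := (abs_le.1 hx).1
  induction n with
  | zero => simp
  | succ n ih =>
    obtain ⟨hp, ih⟩ := ih
    have hn : (0 : ℝ) ≤ n := n.cast_nonneg
    rw [Finset.prod_range_succ, ascPochhammer_succ_right]
    simp only [Polynomial.derivative_mul, Polynomial.eval_mul, Polynomial.eval_add,
      Polynomial.eval_X, Polynomial.eval_natCast, Polynomial.derivative_add,
      Polynomial.derivative_X, Polynomial.derivative_natCast, add_zero, mul_one]
    set p := (ascPochhammer ℝ n).eval x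
    set p' := (ascPochhammer ℝ n).derivative.eval x
    set t := x + (n : ℝ) with ht
    have hte : e < t := by linarith
    have ht0 : 0 < t := by linarith
    refine ⟨mul_pos hp ht0, ?_⟩
    have h1 : |(p * t)⁻¹| = |p⁻¹| * t⁻¹ := by
      rw [mul_inv, abs_mul, abs_of_pos (inv_pos.2 ht0)]
    have h2 : |-(p' * t + p) / (p * t) ^ 2| ≤ |-p' / p ^ 2| * t⁻¹ + |p⁻¹| * t⁻¹ ^ 2 := by
      have : -(p' * t + p) / (p * t) ^ 2 = -p' / p ^ 2 * t⁻¹ - p⁻¹ * t⁻¹ ^ 2 := by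
        field_simp
        ring
      rw [this]
      refine (abs_sub _ _).trans_eq ?_
      rw [abs_mul, abs_mul, abs_of_pos (inv_pos.2 ht0), abs_of_pos (pow_pos (inv_pos.2 ht0) 2)]
    have h3 : t⁻¹ + e * t⁻¹ ^ 2 ≤ (c + n - 2 * e)⁻¹ := by
      have h4 : (t - e)⁻¹ ≤ (c + n - 2 * e)⁻¹ := inv_anti₀ (by linarith) (by linarith)
      refine le_trans ?_ h4
      rw [le_inv_comm₀ (by positivity) (by linarith)]
      rw [← one_div, le_div_iff₀ (by positivity)]
      have : (t - e) * (t⁻¹ + e * t⁻¹ ^ 2) = 1 - e ^ 2 * t⁻¹ ^ 2 := by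
        field_simp
        ring
      rw [this]
      nlinarith [sq_nonneg (e * t⁻¹)]
    have hA : 0 ≤ |p⁻¹| := abs_nonneg _
    have hB : 0 ≤ |-p' / p ^ 2| := abs_nonneg _
    have hti : 0 < t⁻¹ := inv_pos.2 ht0
    calc |(p * t)⁻¹| + e * |-(p' * t + p) / (p * t) ^ 2|
        ≤ |p⁻¹| * t⁻¹ + e * (|-p' / p ^ 2| * t⁻¹ + |p⁻¹| * t⁻¹ ^ 2) := by
          rw [h1]; gcongr
      _ ≤ (|p⁻¹| + e * |-p' / p ^ 2|) * (t⁻¹ + e * t⁻¹ ^ 2) := by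
          have : 0 ≤ e * |-p' / p ^ 2| * (e * t⁻¹ ^ 2) := by positivity
          nlinarith
      _ ≤ _ := mul_le_mul ih h3 (by positivity) (le_trans (by positivity) ih)

theorem majorant_eq (a b c e : ℝ) (n : ℕ) : majorant a b c e n = ((n.factorial : ℝ))⁻¹ *
    (∏ j ∈ Finset.range n, (|a + j| + 2 * e)) * (∏ j ∈ Finset.range n, (|b + j| + 2 * e)) *
      ∏ j ∈ Finset.range n, (c + j - 2 * e)⁻¹ := by
  rw [majorant, Finset.prod_mul_distrib, Finset.prod_mul_distrib, Finset.prod_mul_distrib,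
    Finset.prod_inv_distrib (f := fun j : ℕ => (1 + j : ℝ)), ← Finset.prod_range_add_one_eq_factorial]
  push_cast
  simp_rw [add_comm (1 : ℝ)]
  ring

/-- The `n`-th hypergeometric coefficient as a function of the parameters. -/
noncomputable abbrev coeffFun (n : ℕ) (p : ℝ × ℝ × ℝ) : ℝ :=
  ordinaryHypergeometricCoefficient p.1 p.2.1 p.2.2 n

/-- The derivative of the `n`-th hypergeometric coefficient in the parameters. -/
noncomputable def coeffFDeriv (n : ℕ) (p : ℝ × ℝ × ℝ) : ℝ × ℝ × ℝ →L[ℝ] ℝ :=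
  ((n.factorial : ℝ))⁻¹ •
    (((ascPochhammer ℝ n).derivative.eval p.1 * (ascPochhammer ℝ n).eval p.2.1 *
        ((ascPochhammer ℝ n).eval p.2.2)⁻¹) • ContinuousLinearMap.fst ℝ ℝ (ℝ × ℝ) +
      ((ascPochhammer ℝ n).eval p.1 * (ascPochhammer ℝ n).derivative.eval p.2.1 *
        ((ascPochhammer ℝ n).eval p.2.2)⁻¹) •
          (ContinuousLinearMap.fst ℝ ℝ ℝ ∘L ContinuousLinearMap.snd ℝ ℝ (ℝ × ℝ)) +
      ((ascPochhammer ℝ n).eval p.1 * (ascPochhammer ℝ n).eval p.2.1 *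
        (-(ascPochhammer ℝ n).derivative.eval p.2.2 / (ascPochhammer ℝ n).eval p.2.2 ^ 2)) •
          (ContinuousLinearMap.snd ℝ ℝ ℝ ∘L ContinuousLinearMap.snd ℝ ℝ (ℝ × ℝ)))

theorem hasFDerivAt_coeffFun {n : ℕ} {p : ℝ × ℝ × ℝ} (h : (ascPochhammer ℝ n).eval p.2.2 ≠ 0) :
    HasFDerivAt (coeffFun n) (coeffFDeriv n p) p := by
  have h1 : HasFDerivAt (fun q : ℝ × ℝ × ℝ => (ascPochhammer ℝ n).eval q.1)
      ((ascPochhammer ℝ n).derivative.eval p.1 • ContinuousLinearMap.fst ℝ ℝ (ℝ × ℝ)) p :=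
    ((ascPochhammer ℝ n).hasDerivAt p.1).comp_hasFDerivAt p hasFDerivAt_fst
  have h2 : HasFDerivAt (fun q : ℝ × ℝ × ℝ => (ascPochhammer ℝ n).eval q.2.1)
      ((ascPochhammer ℝ n).derivative.eval p.2.1 •
        (ContinuousLinearMap.fst ℝ ℝ ℝ ∘L ContinuousLinearMap.snd ℝ ℝ (ℝ × ℝ))) p :=
    HasDerivAt.comp_hasFDerivAt p (f := fun q : ℝ × ℝ × ℝ => q.2.1)
      ((ascPochhammer ℝ n).hasDerivAt p.2.1)
      (HasFDerivAt.comp p (g := Prod.fst) (hasFDerivAt_fst (p := p.2)) hasFDerivAt_snd)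
  have h3 : HasFDerivAt (fun q : ℝ × ℝ × ℝ => ((ascPochhammer ℝ n).eval q.2.2)⁻¹)
      ((-(ascPochhammer ℝ n).derivative.eval p.2.2 / (ascPochhammer ℝ n).eval p.2.2 ^ 2) •
        (ContinuousLinearMap.snd ℝ ℝ ℝ ∘L ContinuousLinearMap.snd ℝ ℝ (ℝ × ℝ))) p :=
    HasDerivAt.comp_hasFDerivAt p (f := fun q : ℝ × ℝ × ℝ => q.2.2)
      (((ascPochhammer ℝ n).hasDerivAt p.2.2).inv h)
      (HasFDerivAt.comp p (g := Prod.snd) (hasFDerivAt_snd (p := p.2)) hasFDerivAt_snd)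
  convert! ((h1.const_mul ((n.factorial : ℝ))⁻¹).mul h2).mul h3 using 1
  ext <;> simp [coeffFDeriv] <;> ring

/-- Expanding (A + eA')(B + eB')(C + eC') produces ABC and e(A'BC + AB'C + ABC') among nonnegative
terms, so one product bounds both the coefficient and e times its derivative. -/
theorem coeff_bounds {a b c e : ℝ} (he : 0 < e) (hc : 2 * e < c) {p : ℝ × ℝ × ℝ}
    (h1 : |p.1 - a| ≤ e) (h2 : |p.2.1 - b| ≤ e) (h3 : |p.2.2 - c| ≤ e) (n : ℕ) :
    |coeffFun n p| ≤ majorant a b c e n ∧ ‖coeffFDeriv n p‖ ≤ e⁻¹ * majorant a b c e n := by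
  have b1 := ascPochhammer_bound he h1 n
  have b2 := ascPochhammer_bound he h2 n
  have b3 := (inv_ascPochhammer_bound he hc h3 n).2
  have nf := norm_add₃_le
      (a := ((ascPochhammer ℝ n).derivative.eval p.1 * (ascPochhammer ℝ n).eval p.2.1 *
        ((ascPochhammer ℝ n).eval p.2.2)⁻¹) • ContinuousLinearMap.fst ℝ ℝ (ℝ × ℝ))
      (b := ((ascPochhammer ℝ n).eval p.1 * (ascPochhammer ℝ n).derivative.eval p.2.1 *
        ((ascPochhammer ℝ n).eval p.2.2)⁻¹) •
          (ContinuousLinearMap.fst ℝ ℝ ℝ ∘L ContinuousLinearMap.snd ℝ ℝ (ℝ × ℝ)))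
      (c := ((ascPochhammer ℝ n).eval p.1 * (ascPochhammer ℝ n).eval p.2.1 *
        (-(ascPochhammer ℝ n).derivative.eval p.2.2 / (ascPochhammer ℝ n).eval p.2.2 ^ 2)) •
          (ContinuousLinearMap.snd ℝ ℝ ℝ ∘L ContinuousLinearMap.snd ℝ ℝ (ℝ × ℝ)))
  have n1 : ‖ContinuousLinearMap.fst ℝ ℝ (ℝ × ℝ)‖ ≤ 1 := ContinuousLinearMap.norm_fst_le ..
  have n2 : ‖ContinuousLinearMap.fst ℝ ℝ ℝ ∘L ContinuousLinearMap.snd ℝ ℝ (ℝ × ℝ)‖ ≤ 1 :=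
    (ContinuousLinearMap.opNorm_comp_le _ _).trans (mul_le_one₀
      (ContinuousLinearMap.norm_fst_le ..) (norm_nonneg _) (ContinuousLinearMap.norm_snd_le ..))
  have n3 : ‖ContinuousLinearMap.snd ℝ ℝ ℝ ∘L ContinuousLinearMap.snd ℝ ℝ (ℝ × ℝ)‖ ≤ 1 :=
    (ContinuousLinearMap.opNorm_comp_le _ _).trans (mul_le_one₀
      (ContinuousLinearMap.norm_snd_le ..) (norm_nonneg _) (ContinuousLinearMap.norm_snd_le ..))
  rw [norm_smul, norm_smul, norm_smul] at nf
  simp only [Real.norm_eq_abs, abs_mul] at nf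
  rw [coeffFDeriv, norm_smul, norm_inv, RCLike.norm_natCast, majorant_eq]
  rw [coeffFun, ordinaryHypergeometricCoefficient, abs_mul, abs_mul, abs_mul, abs_inv,
    Nat.abs_cast]
  have hA := abs_nonneg ((ascPochhammer ℝ n).eval p.1)
  have hA' := abs_nonneg ((ascPochhammer ℝ n).derivative.eval p.1)
  have hB := abs_nonneg ((ascPochhammer ℝ n).eval p.2.1)
  have hB' := abs_nonneg ((ascPochhammer ℝ n).derivative.eval p.2.1)
  have hC := abs_nonneg ((ascPochhammer ℝ n).eval p.2.2)⁻¹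
  have hC' := abs_nonneg (-(ascPochhammer ℝ n).derivative.eval p.2.2 /
    (ascPochhammer ℝ n).eval p.2.2 ^ 2)
  generalize |(ascPochhammer ℝ n).eval p.1| = A at *
  generalize |(ascPochhammer ℝ n).derivative.eval p.1| = A' at *
  generalize |(ascPochhammer ℝ n).eval p.2.1| = B at *
  generalize |(ascPochhammer ℝ n).derivative.eval p.2.1| = B' at *
  generalize |((ascPochhammer ℝ n).eval p.2.2)⁻¹| = C at *
  generalize |-(ascPochhammer ℝ n).derivative.eval p.2.2 /
    (ascPochhammer ℝ n).eval p.2.2 ^ 2| = C' at *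
  generalize ∏ j ∈ Finset.range n, (|a + j| + 2 * e) = U at *
  generalize ∏ j ∈ Finset.range n, (|b + j| + 2 * e) = V at *
  generalize ∏ j ∈ Finset.range n, (c + j - 2 * e)⁻¹ = W at *
  have hU : 0 ≤ U := le_trans (by positivity) b1
  have hV : 0 ≤ V := le_trans (by positivity) b2
  have hprod : (A + e * A') * (B + e * B') * (C + e * C') ≤ U * V * W := by gcongr
  have hn : (0 : ℝ) ≤ ((n.factorial : ℝ))⁻¹ := by positivity
  constructor
  · have : A * B * C ≤ U * V * W := by
      refine le_trans ?_ hprod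
      have : 0 ≤ e * A' := by positivity
      have : 0 ≤ e * B' := by positivity
      have : 0 ≤ e * C' := by positivity
      gcongr <;> linarith
    calc _ = ((n.factorial : ℝ))⁻¹ * (A * B * C) := by ring
      _ ≤ ((n.factorial : ℝ))⁻¹ * (U * V * W) := by gcongr
      _ = _ := by ring
  · have h4 : A' * B * C + A * B' * C + A * B * C' ≤ e⁻¹ * (U * V * W) := by
      rw [le_inv_mul_iff₀ he]
      refine le_trans ?_ hprod
      have : 0 ≤ A * B * C := by positivity
      have : 0 ≤ (e * A') * (e * B') * C := by positivity
      have : 0 ≤ (e * A') * B * (e * C') := by positivity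
      have : 0 ≤ A * (e * B') * (e * C') := by positivity
      have : 0 ≤ (e * A') * (e * B') * (e * C') := by positivity
      nlinarith
    have h5 := mul_le_of_le_one_right (by positivity : 0 ≤ A' * B * C) n1
    have h6 := mul_le_of_le_one_right (by positivity : 0 ≤ A * B' * C) n2
    have h7 := mul_le_of_le_one_right (by positivity : 0 ≤ A * B * C') n3
    calc _ ≤ ((n.factorial : ℝ))⁻¹ * (e⁻¹ * (U * V * W)) := by
          refine mul_le_mul_of_nonneg_left (le_trans nf ?_) hn
          linarith
      _ = _ := by ring

theorem F_eq_tsum (a b c z : ℝ) :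
    F a b c z = ∑' n : ℕ, ordinaryHypergeometricCoefficient a b c n * z ^ n := by
  rw [F, ordinaryHypergeometric_eq_tsum]
  simp only [smul_eq_mul]

theorem exists_margin {a b c : ℝ} (hc : 0 < c) (hs : 0 < c - a - b) :
    ∃ e, 0 < e ∧ 2 * e < c ∧ 7 * e ≤ c - a - b := by
  refine ⟨min (c / 3) ((c - a - b) / 7), by positivity, ?_, ?_⟩
  · linarith [min_le_left (c / 3) ((c - a - b) / 7)]
  · linarith [min_le_right (c / 3) ((c - a - b) / 7)]

theorem summable_abs_coeff {a b c : ℝ} (hc : 0 < c) (hs : 0 < c - a - b) :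
    Summable fun n => |ordinaryHypergeometricCoefficient a b c n| := by
  obtain ⟨e, he, hec, hes⟩ := exists_margin hc hs
  refine (summable_majorant he hec hes).of_nonneg_of_le (fun n => abs_nonneg _) fun n => ?_
  exact (coeff_bounds he hec (p := (a, b, c)) (by simpa using he.le) (by simpa using he.le)
    (by simpa using he.le) n).1

theorem summable_coeff_mul_pow {a b c z : ℝ} (hc : 0 < c) (hs : 0 < c - a - b) (hz : |z| ≤ 1) :
    Summable fun n => ordinaryHypergeometricCoefficient a b c n * z ^ n := by
  refine (summable_abs_coeff hc hs).of_norm_bounded fun n => ?_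
  rw [Real.norm_eq_abs, abs_mul, abs_pow]
  exact mul_le_of_le_one_right (abs_nonneg _) (pow_le_one₀ (abs_nonneg _) hz)

/-- Up to the boundary of the unit disc, the hypergeometric function is differentiable in its
parameters jointly. -/
theorem differentiableAt_F {a b c z : ℝ} (hc : 0 < c) (hs : 0 < c - a - b) (hz : |z| ≤ 1) :
    DifferentiableAt ℝ (fun p : ℝ × ℝ × ℝ => F p.1 p.2.1 p.2.2 z) (a, b, c) := by
  obtain ⟨e, he, hec, hes⟩ := exists_margin hc hs
  simp_rw [F_eq_tsum]
  have hball : ∀ p ∈ Metric.ball ((a, b, c) : ℝ × ℝ × ℝ) e,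
      |p.1 - a| ≤ e ∧ |p.2.1 - b| ≤ e ∧ |p.2.2 - c| ≤ e := by
    intro p hp
    rw [Metric.mem_ball, Prod.dist_eq, Prod.dist_eq, max_lt_iff, max_lt_iff] at hp
    simp only [Real.dist_eq] at hp
    exact ⟨hp.1.le, hp.2.1.le, hp.2.2.le⟩
  have hzn : ∀ n : ℕ, |z ^ n| ≤ 1 := fun n => by
    rw [abs_pow]; exact pow_le_one₀ (abs_nonneg _) hz
  refine (hasFDerivAt_tsum_of_isPreconnected (u := fun n => e⁻¹ * majorant a b c e n)
    (f := fun n (p : ℝ × ℝ × ℝ) => coeffFun n p * z ^ n)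
    (f' := fun n p => z ^ n • coeffFDeriv n p)
    ((summable_majorant he hec hes).mul_left _) Metric.isOpen_ball
    (convex_ball ((a, b, c) : ℝ × ℝ × ℝ) e).isPreconnected
    (fun n p hp => ?_) (fun n p hp => ?_) (Metric.mem_ball_self he)
    (summable_coeff_mul_pow hc hs hz) (Metric.mem_ball_self he)).differentiableAt
  · obtain ⟨-, -, h3⟩ := hball p hp
    exact (hasFDerivAt_coeffFun (inv_ascPochhammer_bound he hec h3 n).1.ne').mul_const _
  · obtain ⟨h1, h2, h3⟩ := hball p hp
    rw [norm_smul, Real.norm_eq_abs]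
    exact (mul_le_of_le_one_left (norm_nonneg _) (hzn n)).trans (coeff_bounds he hec h1 h2 h3 n).2

theorem fRegularAt {a b c z : ℝ} (hc : 0 < c) (hs : 0 < c - a - b) (hz : |z| ≤ 1) :
    FRegularAt a b c z := by
  have h := differentiableAt_F hc hs hz
  refine ⟨summable_coeff_mul_pow hc hs hz, ?_, ?_, ?_⟩
  · exact DifferentiableAt.comp (g := fun p : ℝ × ℝ × ℝ => F p.1 p.2.1 p.2.2 z)
      (f := fun s : ℝ => (s, b, c)) a h (by fun_prop)
  · exact DifferentiableAt.comp (g := fun p : ℝ × ℝ × ℝ => F p.1 p.2.1 p.2.2 z)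
      (f := fun s : ℝ => (a, s, c)) b h (by fun_prop)
  · exact DifferentiableAt.comp (g := fun p : ℝ × ℝ × ℝ => F p.1 p.2.1 p.2.2 z)
      (f := fun s : ℝ => (a, b, s)) c h (by fun_prop)

/-- The chain rule for the hypergeometric function along a curve of parameters. -/
theorem hasDerivAt_F_comp {a b c : ℝ → ℝ} {a' b' c' t z : ℝ} (ha : HasDerivAt a a' t)
    (hb : HasDerivAt b b' t) (hcd : HasDerivAt c c' t) (hc : 0 < c t)
    (hs : 0 < c t - a t - b t) (hz : |z| ≤ 1) :
    HasDerivAt (fun q => F (a q) (b q) (c q) z)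
      (a' * Fa (a t) (b t) (c t) z + b' * Fb (a t) (b t) (c t) z + c' * Fc (a t) (b t) (c t) z)
      t := by
  have h := (differentiableAt_F hc hs hz).hasFDerivAt
  set L := fderiv ℝ (fun p : ℝ × ℝ × ℝ => F p.1 p.2.1 p.2.2 z) (a t, b t, c t)
  have key := h.comp_hasDerivAt t (ha.prodMk (hb.prodMk hcd))
  have e1 : Fa (a t) (b t) (c t) z = L (1, 0, 0) :=
    (HasFDerivAt.comp_hasDerivAt (a t) (f := fun s : ℝ => (s, b t, c t)) h
      ((hasDerivAt_id (a t)).prodMk (hasDerivAt_const _ _))).deriv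
  have e2 : Fb (a t) (b t) (c t) z = L (0, 1, 0) :=
    (HasFDerivAt.comp_hasDerivAt (b t) (f := fun s : ℝ => (a t, s, c t)) h
      ((hasDerivAt_const _ _).prodMk ((hasDerivAt_id (b t)).prodMk (hasDerivAt_const _ _)))).deriv
  have e3 : Fc (a t) (b t) (c t) z = L (0, 0, 1) :=
    (HasFDerivAt.comp_hasDerivAt (c t) (f := fun s : ℝ => (a t, b t, s)) h
      ((hasDerivAt_const _ _).prodMk ((hasDerivAt_const _ _).prodMk (hasDerivAt_id (c t))))).deriv
  convert! key using 1
  rw [e1, e2, e3, ← smul_eq_mul, ← smul_eq_mul, ← smul_eq_mul, ← map_smul, ← map_smul, ← map_smul,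
    ← map_add, ← map_add]
  simp

/-! ### Gauss's summation at argument 1 -/

theorem ascPochhammer_add_one_mul (a : ℝ) (n : ℕ) :
    a * (ascPochhammer ℝ n).eval (a + 1) = (ascPochhammer ℝ n).eval a * (a + n) := by
  induction n with
  | zero => simp
  | succ n ih =>
    rw [ascPochhammer_succ_eval, ← mul_assoc, ih, ascPochhammer_succ_eval]
    push_cast
    ring

theorem hasSum_one_sub_rpow (b : ℝ) {t : ℝ} (h0 : 0 < t) (h1 : t < 1) :
    HasSum (fun n : ℕ => ((n.factorial : ℝ))⁻¹ * (ascPochhammer ℝ n).eval b * t ^ n)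
      ((1 - t) ^ (-b)) := by
  have h := (Real.one_div_one_sub_rpow_hasFPowerSeriesOnBall_zero b).hasSum (y := t) (by
    simp [enorm_eq_nnnorm, ← NNReal.coe_lt_coe, abs_of_pos h0, h1])
  simp only [FormalMultilinearSeries.ofScalars_apply_eq, zero_add, smul_eq_mul] at h
  convert! h using 1
  · ext n
    have := Ring.factorial_nsmul_multichoose_eq_ascPochhammer b n
    rw [Polynomial.ascPochhammer_smeval_eq_eval, nsmul_eq_mul] at this
    rw [← Ring.multichoose_eq, ← this]
    field_simp
  · rw [Real.rpow_neg (by linarith), one_div]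

theorem integral_Ioo_rpow_mul_pow {a : ℝ} (ha : 0 < a) (n : ℕ) :
    IntegrableOn (fun t : ℝ => t ^ (a - 1) * t ^ n) (Set.Ioo 0 1) ∧
    ∫ t in Set.Ioo (0 : ℝ) 1, t ^ (a - 1) * t ^ n = (a + n)⁻¹ := by
  have hn : (0 : ℝ) ≤ n := n.cast_nonneg
  have hcongr : Set.EqOn (fun t : ℝ => t ^ (a - 1 + n)) (fun t : ℝ => t ^ (a - 1) * t ^ n)
      (Set.Ioo 0 1) := fun t ht => Real.rpow_add_natCast ht.1.ne' _ _
  have hint : IntervalIntegrable (fun t : ℝ => t ^ (a - 1 + n)) volume 0 1 :=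
    intervalIntegral.intervalIntegrable_rpow' (by linarith)
  constructor
  · refine (IntegrableOn.congr_fun ?_ hcongr measurableSet_Ioo)
    exact (intervalIntegrable_iff_integrableOn_Ioo_of_le zero_le_one).1 hint
  · rw [← setIntegral_congr_fun measurableSet_Ioo hcongr, ← integral_Ioc_eq_integral_Ioo,
      ← intervalIntegral.integral_of_le zero_le_one, integral_rpow (Or.inl (by linarith)),
      Real.one_rpow, Real.zero_rpow (by linarith)]
    rw [show a - 1 + n + 1 = a + n by ring]
    simp

theorem integral_Ioo_beta {a b : ℝ} (ha : 0 < a) (hb : 0 < b) :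
    ∫ t in Set.Ioo (0 : ℝ) 1, t ^ (a - 1) * (1 - t) ^ (b - 1) =
      Real.Gamma a * Real.Gamma b / Real.Gamma (a + b) := by
  have hB := beta_pos ha hb
  have h := lintegral_betaPDF_eq_one ha hb
  rw [lintegral_betaPDF, ← ENNReal.toReal_eq_one_iff, ← integral_eq_lintegral_of_nonneg_ae] at h
  · simp_rw [mul_assoc, integral_const_mul] at h
    rw [one_div, inv_mul_eq_iff_eq_mul₀ hB.ne', mul_one] at h
    exact h
  · refine ae_restrict_of_forall_mem measurableSet_Ioo fun x hx => ?_
    have h1 : 0 < 1 - x := by linarith [hx.2]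
    have h2 := hx.1
    simp only [Pi.zero_apply]
    positivity
  · exact Measurable.aestronglyMeasurable (by fun_prop)

/-- Gauss's summation theorem in the case `c = a + 1`. -/
theorem F_one {a b : ℝ} (ha : 0 < a) (hb : b < 1) :
    F a b (a + 1) 1 = Real.Gamma (a + 1) * Real.Gamma (1 - b) / Real.Gamma (a + 1 - b) := by
  set β : ℕ → ℝ := fun n => ((n.factorial : ℝ))⁻¹ * (ascPochhammer ℝ n).eval b with hβ
  have han : ∀ n : ℕ, 0 < a + n := fun n => by positivity
  -- For c = a + 1 the Pochhammer quotient collapses to a/(a + n), and 1/(a + n) is the integral of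
  -- t^(a - 1 + n) over (0, 1). The sum becomes a beta integral by the binomial series; absolute
  -- summability justifies the interchange.
  have hcoeff : ∀ n, ordinaryHypergeometricCoefficient a b (a + 1) n = a * (β n * (a + n)⁻¹) := by
    intro n
    have h0 : 0 < (ascPochhammer ℝ n).eval (a + 1) := ascPochhammer_pos n _ (by linarith)
    have h1 := ascPochhammer_add_one_mul a n
    have h2 := han n
    have h3 : (ascPochhammer ℝ n).eval a * ((ascPochhammer ℝ n).eval (a + 1))⁻¹ =
        a * (a + n)⁻¹ := by
      field_simp
      linarith
    rw [ordinaryHypergeometricCoefficient, hβ]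
    linear_combination ((n.factorial : ℝ))⁻¹ * (ascPochhammer ℝ n).eval b * h3
  have hsum : Summable fun n => |β n| * (a + n)⁻¹ := by
    have h := (summable_abs_coeff (a := a) (b := b) (c := a + 1) (by linarith)
      (by linarith)).mul_left a⁻¹
    refine h.congr fun n => ?_
    rw [hcoeff, abs_mul, abs_mul, abs_of_pos ha, abs_of_pos (inv_pos.2 (han n))]
    field_simp
  have key := hasSum_integral_of_summable_integral_norm
    (μ := volume.restrict (Set.Ioo (0 : ℝ) 1))
    (F := fun (n : ℕ) (t : ℝ) => β n * (t ^ (a - 1) * t ^ n))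
    (fun n => ((integral_Ioo_rpow_mul_pow ha n).1).const_mul _) (by
      refine hsum.congr fun n => ?_
      rw [← (integral_Ioo_rpow_mul_pow ha n).2, ← integral_const_mul]
      refine setIntegral_congr_fun measurableSet_Ioo fun t ht => ?_
      have := ht.1
      simp only [Real.norm_eq_abs, abs_mul]
      rw [abs_of_pos (Real.rpow_pos_of_pos ht.1 _), abs_of_pos (pow_pos ht.1 _)])
  have hint : ∫ t in Set.Ioo (0 : ℝ) 1, ∑' n, β n * (t ^ (a - 1) * t ^ n) =
      ∫ t in Set.Ioo (0 : ℝ) 1, t ^ (a - 1) * (1 - t) ^ ((1 - b) - 1) := by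
    refine setIntegral_congr_fun measurableSet_Ioo fun t ht => ?_
    have h := ((hasSum_one_sub_rpow b ht.1 ht.2).mul_left (t ^ (a - 1))).tsum_eq
    rw [show 1 - b - 1 = -b by ring, ← h]
    exact tsum_congr fun n => by simp only [hβ]; ring
  simp_rw [integral_const_mul, (integral_Ioo_rpow_mul_pow ha _).2] at key
  rw [hint, integral_Ioo_beta ha (by linarith)] at key
  rw [F_eq_tsum]
  simp_rw [hcoeff, one_pow, mul_one]
  rw [(key.mul_left a).tsum_eq, Real.Gamma_add_one ha.ne', show a + (1 - b) = a + 1 - b by ring]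
  ring

/-! ### Descending power series and their boundary values at 1 -/

/-- The generalized power series `∑ f n * y ^ (-k - n)`. -/
noncomputable def descSeries (k : ℝ) (f : ℕ → ℝ) (y : ℝ) : ℝ := y ^ (-k) * ∑' n, f n * y⁻¹ ^ n

theorem exists_hasDerivAt_powerSeries {f : ℕ → ℝ} (hf : Summable fun n => |f n|) {z : ℝ}
    (hz : |z| < 1) : ∃ D, HasDerivAt (fun z => ∑' n, f n * z ^ n) D z ∧
      HasSum (fun n => n * f n * z ^ n) (z * D) := by
  obtain ⟨ρ, hzρ, hρ1⟩ := exists_between hz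
  have hρ0 : 0 < ρ := (abs_nonneg z).trans_lt hzρ
  have hρn : ‖ρ‖ < 1 := by rwa [Real.norm_eq_abs, abs_of_pos hρ0]
  have hgeom : Summable fun n : ℕ => (n : ℝ) ^ 1 * ρ ^ n :=
    summable_pow_mul_geometric_of_norm_lt_one 1 hρn
  have hu : Summable fun n : ℕ => (∑' i, |f i|) * ρ⁻¹ * ((n : ℝ) ^ 1 * ρ ^ n) :=
    hgeom.mul_left ((∑' i, |f i|) * ρ⁻¹)
  have hfb : ∀ n, |f n| ≤ ∑' i, |f i| := fun n => hf.le_tsum n fun j _ => abs_nonneg _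
  have hb : ∀ (n : ℕ) (w : ℝ), w ∈ Metric.ball (0 : ℝ) ρ →
      ‖f n * (n * w ^ (n - 1))‖ ≤ (∑' i, |f i|) * ρ⁻¹ * ((n : ℝ) ^ 1 * ρ ^ n) := by
    intro n w hw
    rw [mem_ball_zero_iff, Real.norm_eq_abs] at hw
    have h1 : ρ⁻¹ * ((n : ℝ) ^ 1 * ρ ^ n) = n * ρ ^ (n - 1) := by
      cases n with
      | zero => simp
      | succ m =>
        rw [Nat.add_sub_cancel, pow_one, pow_succ]
        field_simp
    rw [Real.norm_eq_abs, abs_mul, abs_mul, abs_pow, Nat.abs_cast, mul_assoc, h1]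
    exact mul_le_mul (hfb n) (mul_le_mul_of_nonneg_left
      (pow_le_pow_left₀ (abs_nonneg _) hw.le _) n.cast_nonneg) (by positivity)
      ((abs_nonneg _).trans (hfb n))
  have hs0 : Summable fun n => f n * z ^ n := by
    refine hf.of_norm_bounded fun n => ?_
    rw [Real.norm_eq_abs, abs_mul, abs_pow]
    exact mul_le_of_le_one_right (abs_nonneg _) (pow_le_one₀ (abs_nonneg _) hz.le)
  have hzm : z ∈ Metric.ball (0 : ℝ) ρ := by rwa [mem_ball_zero_iff, Real.norm_eq_abs]
  have hd : HasDerivAt (fun z => ∑' n, f n * z ^ n) (∑' n : ℕ, f n * (n * z ^ (n - 1))) z :=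
    hasDerivAt_tsum_of_isPreconnected (g := fun n w => f n * w ^ n)
    (g' := fun n w => f n * (n * w ^ (n - 1))) hu Metric.isOpen_ball
    (convex_ball (0 : ℝ) ρ).isPreconnected
    (fun n w _ => (hasDerivAt_pow n w).const_mul (f n)) hb hzm hs0 hzm
  refine ⟨∑' n : ℕ, f n * (n * z ^ (n - 1)), hd, ?_⟩
  have hs : Summable fun n : ℕ => f n * (n * z ^ (n - 1)) :=
    hu.of_norm_bounded fun n => hb n z hzm
  refine (hs.hasSum.mul_left z).congr_fun fun n => ?_
  cases n with
  | zero => simp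
  | succ m =>
    rw [Nat.add_sub_cancel, pow_succ]
    ring

theorem summable_mul_inv_pow {f : ℕ → ℝ} (hf : Summable fun n => |f n|) {y : ℝ} (hy : 1 ≤ y) :
    Summable fun n => f n * y⁻¹ ^ n := by
  have h0 : 0 ≤ y⁻¹ := by positivity
  refine hf.of_norm_bounded fun n => ?_
  rw [Real.norm_eq_abs, abs_mul, abs_pow, abs_of_nonneg h0]
  exact mul_le_of_le_one_right (abs_nonneg _) (pow_le_one₀ h0 (inv_le_one_of_one_le₀ hy))

/-- The operator -y d/dy is diagonal on these series, with eigenvalues k + n. Hence the statement is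
about y * D rather than D. -/
theorem exists_hasDerivAt_descSeries {k : ℝ} {f : ℕ → ℝ} (hf : Summable fun n => |f n|) {y : ℝ}
    (hy : 1 < y) : ∃ D, HasDerivAt (descSeries k f) D y ∧
      HasSum (fun n => y ^ (-k) * ((k + n) * f n * y⁻¹ ^ n)) (-(y * D)) := by
  have hy0 : 0 < y := by linarith
  obtain ⟨D, hD, hS⟩ := exists_hasDerivAt_powerSeries hf (z := y⁻¹)
    (by rw [abs_of_pos (inv_pos.2 hy0)]; exact inv_lt_one_of_one_lt₀ hy)
  have h1 := HasDerivAt.comp y (h₂ := fun z => ∑' n, f n * z ^ n) hD (hasDerivAt_inv hy0.ne')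
  have h2 := (Real.hasDerivAt_rpow_const (x := y) (p := -k) (Or.inl hy0.ne')).mul h1
  refine ⟨_, h2, ?_⟩
  have h3 := (((summable_mul_inv_pow hf hy.le).hasSum.mul_left k).add hS).mul_left (y ^ (-k))
  convert! h3 using 1
  · ext n
    ring
  · rw [Real.rpow_sub_one hy0.ne', Function.comp]
    field_simp
    ring

theorem continuousOn_descSeries {k : ℝ} {f : ℕ → ℝ} (hf : Summable fun n => |f n|) :
    ContinuousOn (descSeries k f) (Set.Ici 1) := by
  have h0 : ∀ y ∈ Set.Ici (1 : ℝ), y ≠ 0 := fun y hy => by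
    have : (1 : ℝ) ≤ y := hy
    positivity
  refine ContinuousOn.mul (fun y hy => ?_) (continuousOn_tsum (fun n => ?_) hf fun n y hy => ?_)
  · exact (Real.continuousAt_rpow_const _ _ (Or.inl (h0 y hy))).continuousWithinAt
  · exact continuousOn_const.mul ((continuousOn_inv₀.mono h0).pow n)
  · have hy1 : (1 : ℝ) ≤ y := hy
    have hy0 : 0 ≤ y⁻¹ := by positivity
    rw [Real.norm_eq_abs, abs_mul, abs_pow, abs_of_nonneg hy0]
    exact mul_le_of_le_one_right (abs_nonneg _) (pow_le_one₀ hy0 (inv_le_one_of_one_le₀ hy1))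

theorem abs_descSeries_le {k : ℝ} (hk : 0 ≤ k) {f : ℕ → ℝ} (hf : Summable fun n => |f n|) {y : ℝ}
    (hy : 1 ≤ y) : |descSeries k f y| ≤ ∑' n, |f n| := by
  have hy0 : 0 ≤ y⁻¹ := by positivity
  rw [descSeries, abs_mul, abs_of_nonneg (Real.rpow_nonneg (by linarith) _)]
  refine le_trans (mul_le_of_le_one_left (abs_nonneg _)
    (Real.rpow_le_one_of_one_le_of_nonpos hy (by linarith))) ?_
  refine tsum_of_norm_bounded (f := fun n => f n * y⁻¹ ^ n) hf.hasSum fun n => ?_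
  rw [Real.norm_eq_abs, abs_mul, abs_pow, abs_of_nonneg hy0]
  exact mul_le_of_le_one_right (abs_nonneg _) (pow_le_one₀ hy0 (inv_le_one_of_one_le₀ hy))

/-- A nonzero limit would bound |f n| below by a multiple of 1/n, and the harmonic series diverges.
-/
theorem tendsto_zero_of_summable_of_tendsto {f : ℕ → ℝ} {ℓ k : ℝ} (hf : Summable fun n => |f n|)
    (h : Tendsto (fun n : ℕ => (k + n) * f n) atTop (𝓝 ℓ)) : ℓ = 0 := by
  by_contra hℓ
  have h0 : Tendsto f atTop (𝓝 0) := (summable_abs_iff.1 hf).tendsto_atTop_zero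
  have h1 : Tendsto (fun n : ℕ => (n : ℝ) * f n) atTop (𝓝 ℓ) := by
    have := h.sub (h0.const_mul k)
    rw [mul_zero, sub_zero] at this
    exact this.congr fun n => by ring
  have h2 : ∀ᶠ n : ℕ in atTop, |ℓ| / 2 < |(n : ℝ) * f n| :=
    h1.abs.eventually (lt_mem_nhds (by linarith [abs_pos.2 hℓ]))
  refine Real.not_summable_natCast_inv ?_
  refine Summable.of_norm_bounded_eventually_nat (hf.mul_left (2 / |ℓ|)) ?_
  filter_upwards [h2, eventually_gt_atTop 0] with n hn hn0
  have hn0' : (0 : ℝ) < n := Nat.cast_pos.2 hn0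
  have hl := abs_pos.2 hℓ
  rw [abs_mul, Nat.abs_cast] at hn
  rw [Real.norm_eq_abs, abs_of_pos (inv_pos.2 hn0'), inv_le_iff_one_le_mul₀' hn0']
  rw [div_mul_eq_mul_div, mul_div_assoc', le_div_iff₀ hl]
  linarith

/-- The coefficients obtained from `f` by the first-order differential operator
`L - ρ (y - 1) d/dy` acting on `∑ f n * y ^ (-k - n)`. -/
noncomputable def averageCoeff (L ρ k : ℝ) (f : ℕ → ℝ) : ℕ → ℝ
  | 0 => (L + ρ * k) * f 0
  | n + 1 => (L + ρ * (k + (n + 1 : ℕ))) * f (n + 1) - ρ * (k + n) * f n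

/-- The part -ρ y d/dy multiplies the n-th coefficient by ρ(k + n); the part ρ d/dy does so with the
opposite sign and moves the result to index n + 1. -/
theorem sub_mul_deriv_descSeries {L ρ k : ℝ} {f : ℕ → ℝ} (hf : Summable fun n => |f n|)
    (hg : Summable fun n => |averageCoeff L ρ k f n|) {y D : ℝ} (hy : 1 < y)
    (hD : HasDerivAt (descSeries k f) D y) :
    L * descSeries k f y - ρ * (y - 1) * D = descSeries k (averageCoeff L ρ k f) y := by
  have hy0 : 0 < y := by linarith
  obtain ⟨D', hD', hS⟩ := exists_hasDerivAt_descSeries (k := k) hf hy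
  obtain rfl := hD'.unique hD
  have hf' := ((summable_mul_inv_pow hf hy.le).hasSum.mul_left (y ^ (-k))).mul_left L
  have h1 := hf'.add (hS.mul_left ρ)
  have h2 := (hS.mul_left (ρ * y⁻¹))
  have hshift : HasSum (fun n : ℕ => y ^ (-k) * (averageCoeff L ρ k f n * y⁻¹ ^ n))
      (descSeries k (averageCoeff L ρ k f) y) :=
    (summable_mul_inv_pow hg hy.le).hasSum.mul_left _
  have e1 := (hasSum_nat_add_iff' 1).2 h1
  have e2 := (hasSum_nat_add_iff' 1).2 hshift
  have e3 := (e1.sub h2).unique (e2.congr_fun (fun n => by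
    simp only [averageCoeff, pow_succ]; push_cast; ring))
  simp only [Finset.sum_range_one, averageCoeff, pow_zero, Nat.cast_zero] at e3
  simp only [descSeries] at e3 ⊢
  have : y⁻¹ * y = 1 := inv_mul_cancel₀ hy0.ne'
  linear_combination e3 - ρ * D' * this

/-- No derivative at y = 1 is available, so the boundary value comes from partial sums: they
telescope to L times those of f plus ρ(k + n) f n. The last term converges because the sums do, and
its limit is then 0 by summability of f. -/
theorem descSeries_averageCoeff_one {L ρ k : ℝ} {f : ℕ → ℝ} (hρ : ρ ≠ 0)
    (hf : Summable fun n => |f n|) (hg : Summable fun n => |averageCoeff L ρ k f n|) :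
    descSeries k (averageCoeff L ρ k f) 1 = L * descSeries k f 1 := by
  have hpart : ∀ n : ℕ, ∑ i ∈ Finset.range (n + 1), averageCoeff L ρ k f i =
      L * ∑ i ∈ Finset.range (n + 1), f i + ρ * ((k + n) * f n) := by
    intro n
    induction n with
    | zero => simp [averageCoeff]; ring
    | succ n ih =>
      rw [Finset.sum_range_succ, ih, Finset.sum_range_succ _ (n + 1), averageCoeff]
      ring
  have t1 := ((summable_abs_iff.1 hg).hasSum.tendsto_sum_nat).comp (tendsto_add_atTop_nat 1)
  have t2 := ((summable_abs_iff.1 hf).hasSum.tendsto_sum_nat).comp (tendsto_add_atTop_nat 1)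
  have t3 := (t1.sub (t2.const_mul L)).const_mul ρ⁻¹
  have t4 := tendsto_zero_of_summable_of_tendsto hf (k := k) (t3.congr fun n => by
    simp only [Function.comp]
    rw [hpart]
    field_simp
    ring)
  rw [mul_eq_zero, or_iff_right (inv_ne_zero hρ), sub_eq_zero] at t4
  simpa [descSeries] using t4

/-! ### The renewal equation from two first-order differential equations -/

theorem integral_betaMeasure_one {α : ℝ} (hα : 0 < α) (f : ℝ → ℝ) :
    ∫ z, f z ∂betaMeasure α 1 = ∫ z in Set.Ioo (0 : ℝ) 1, α * z ^ (α - 1) * f z := by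
  have hm : Measurable (betaPDF α 1) := (measurable_betaPDFReal α 1).ennreal_ofReal
  rw [betaMeasure, integral_withDensity_eq_integral_toReal_smul hm (ae_of_all _ fun _ => ENNReal.ofReal_lt_top),
    ← integral_indicator measurableSet_Ioo]
  congr 1
  ext z
  rw [betaPDF, Set.indicator_apply]
  by_cases hz : z ∈ Set.Ioo (0 : ℝ) 1
  · have hpos := betaPDFReal_pos hz.1 hz.2 hα one_pos
    rw [if_pos hz, ENNReal.toReal_ofReal hpos.le, betaPDFReal, if_pos ⟨hz.1, hz.2⟩, sub_self,
      Real.rpow_zero, mul_one, beta, Real.Gamma_add_one hα.ne', Real.Gamma_one, mul_one, smul_eq_mul]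
    have := (Real.Gamma_pos_of_pos hα).ne'
    field_simp
  · rw [if_neg hz, betaPDFReal, if_neg (by simpa using hz)]
    simp

theorem integral_expMeasure {l : ℝ} (hl : 0 < l) (f : ℝ → ℝ) :
    ∫ s, f s ∂expMeasure l = ∫ s in Set.Ioi (0 : ℝ), l * Real.exp (-(l * s)) * f s := by
  have hm : Measurable (exponentialPDF l) := (measurable_exponentialPDFReal l).ennreal_ofReal
  have hd : expMeasure l = volume.withDensity (exponentialPDF l) := rfl
  rw [hd, integral_withDensity_eq_integral_toReal_smul hm
    (ae_of_all _ fun _ => ENNReal.ofReal_lt_top), ← integral_Ici_eq_integral_Ioi,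
    ← integral_indicator measurableSet_Ici]
  congr 1
  ext s
  rw [Set.indicator_apply]
  by_cases hs : s ∈ Set.Ici (0 : ℝ)
  · rw [if_pos hs, exponentialPDF_of_nonneg hs, ENNReal.toReal_ofReal (by positivity), smul_eq_mul]
  · rw [if_neg hs, exponentialPDF_of_neg (not_le.1 hs)]
    simp

/-- The reward `H` above the level `1`, extended by `1` below it. -/
noncomputable def withTrap (H : ℝ → ℝ) (t : ℝ) : ℝ := if t < 1 then 1 else H t

/-- The integral of `withTrap H` against the law of the remaining proportion. -/
theorem integral_beta_withTrap {α : ℝ} (hα : 0 < α) {H G : ℝ → ℝ}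
    (hH : ContinuousOn H (Set.Ici 1)) (hG : ContinuousOn G (Set.Ici 1))
    (hG' : ∀ y, 1 < y → HasDerivAt G (α * (H y - G y) / y) y) (hG1 : G 1 = 1) {Y : ℝ}
    (hY : 1 ≤ Y) : ∫ z, withTrap H (Y * z) ∂betaMeasure α 1 = G Y := by
  have hY0 : 0 < Y := by linarith
  have hYi : Y⁻¹ ≤ 1 := inv_le_one_of_one_le₀ hY
  have hYi0 : 0 < Y⁻¹ := inv_pos.2 hY0
  rw [integral_betaMeasure_one hα, ← integral_Ioc_eq_integral_Ioo,
    ← intervalIntegral.integral_of_le zero_le_one]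
  have e1 : ∀ z ∈ Set.Ioo 0 Y⁻¹, α * z ^ (α - 1) * 1 = α * z ^ (α - 1) * withTrap H (Y * z) := by
    intro z hz
    have : Y * z < 1 := by
      have := mul_lt_mul_of_pos_left hz.2 hY0
      rwa [mul_inv_cancel₀ hY0.ne'] at this
    rw [withTrap, if_pos this]
  have e2 : ∀ z ∈ Set.Ioc Y⁻¹ 1, α * z ^ (α - 1) * H (Y * z) =
      α * z ^ (α - 1) * withTrap H (Y * z) := by
    intro z hz
    have : 1 < Y * z := by
      have := mul_lt_mul_of_pos_left hz.1 hY0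
      rwa [mul_inv_cancel₀ hY0.ne'] at this
    rw [withTrap, if_neg this.le.not_gt]
  have hmaps : Set.MapsTo (fun z => Y * z) (Set.Icc Y⁻¹ 1) (Set.Ici 1) := by
    intro z hz
    have := mul_le_mul_of_nonneg_left hz.1 hY0.le
    rwa [mul_inv_cancel₀ hY0.ne'] at this
  have hcomp : ContinuousOn (fun z => H (Y * z)) (Set.Icc Y⁻¹ 1) :=
    hH.comp (by fun_prop) hmaps
  have hcompG : ContinuousOn (fun z => G (Y * z)) (Set.Icc Y⁻¹ 1) :=
    hG.comp (by fun_prop) hmaps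
  have hrpow : ∀ p : ℝ, ContinuousOn (fun z : ℝ => z ^ p) (Set.Icc Y⁻¹ 1) := fun p z hz =>
    (Real.continuousAt_rpow_const _ _ (Or.inl (hYi0.trans_le hz.1).ne')).continuousWithinAt
  have i1' : IntervalIntegrable (fun z : ℝ => α * z ^ (α - 1) * 1) volume 0 Y⁻¹ :=
    ((intervalIntegral.intervalIntegrable_rpow' (by linarith)).const_mul α).mul_const 1
  have i2' : IntervalIntegrable (fun z : ℝ => α * z ^ (α - 1) * H (Y * z)) volume Y⁻¹ 1 :=
    ((continuousOn_const.mul (hrpow _)).mul hcomp).intervalIntegrable_of_Icc hYi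
  have i1 : IntervalIntegrable (fun z : ℝ => α * z ^ (α - 1) * withTrap H (Y * z))
      volume 0 Y⁻¹ := by
    rw [intervalIntegrable_iff_integrableOn_Ioo_of_le hYi0.le] at i1' ⊢
    exact i1'.congr_fun e1 measurableSet_Ioo
  have i2 : IntervalIntegrable (fun z : ℝ => α * z ^ (α - 1) * withTrap H (Y * z))
      volume Y⁻¹ 1 := by
    rw [intervalIntegrable_iff_integrableOn_Ioc_of_le hYi] at i2' ⊢
    exact i2'.congr_fun e2 measurableSet_Ioc
  rw [← intervalIntegral.integral_add_adjacent_intervals i1 i2]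
  -- Proportions below 1/Y lead to trapping and have reward 1. Above 1/Y the equation for G makes
  -- z^α G(Yz) an antiderivative of the integrand.
  have v1 : ∫ z in (0 : ℝ)..Y⁻¹, α * z ^ (α - 1) * withTrap H (Y * z) = Y⁻¹ ^ α := by
    rw [intervalIntegral.integral_of_le hYi0.le, integral_Ioc_eq_integral_Ioo,
      ← setIntegral_congr_fun measurableSet_Ioo e1, ← integral_Ioc_eq_integral_Ioo,
      ← intervalIntegral.integral_of_le hYi0.le, intervalIntegral.integral_mul_const,
      intervalIntegral.integral_const_mul, integral_rpow (Or.inl (by linarith))]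
    rw [sub_add_cancel, Real.zero_rpow hα.ne']
    field_simp
    ring
  have v2 : ∫ z in Y⁻¹..1, α * z ^ (α - 1) * withTrap H (Y * z) = G Y - Y⁻¹ ^ α := by
    rw [intervalIntegral.integral_of_le hYi, ← setIntegral_congr_fun measurableSet_Ioc e2,
      ← intervalIntegral.integral_of_le hYi,
      intervalIntegral.integral_eq_sub_of_hasDerivAt_of_le hYi (f := fun z => z ^ α * G (Y * z))
        ((hrpow α).mul hcompG) ?_ i2']
    · rw [mul_inv_cancel₀ hY0.ne', hG1]
      simp
    · intro z hz
      have hz0 : 0 < z := hYi0.trans hz.1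
      have hYz : 1 < Y * z := by
        have := mul_lt_mul_of_pos_left hz.1 hY0
        rwa [mul_inv_cancel₀ hY0.ne'] at this
      have h1 := Real.hasDerivAt_rpow_const (x := z) (p := α) (Or.inl hz0.ne')
      have h2 := (hG' _ hYz).comp z ((hasDerivAt_id z).const_mul Y)
      convert! h1.mul h2 using 1
      have h3 : z ^ α = z * z ^ (α - 1) := by
        rw [Real.rpow_sub_one hz0.ne']
        field_simp
      simp only [Function.comp]
      rw [h3]
      field_simp
      ring
  rw [v1, v2]
  ring

/-- The integral of the reward against the law of the inter-arrival time, along the loss-free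
growth. -/
theorem integral_exp_growth {r l q : ℝ} (hl : 0 < l) (hq : 0 ≤ q) {H G : ℝ → ℝ} {B : ℝ}
    (hHB : ∀ y, 1 ≤ y → |H y| ≤ B) (hGB : ∀ y, 1 ≤ y → |G y| ≤ B)
    (hG : ContinuousOn G (Set.Ici 1))
    (hH' : ∀ y, 1 < y → ∃ D, HasDerivAt H D y ∧ (l + q) * H y - r * (y - 1) * D = l * G y)
    (hH1 : (l + q) * H 1 = l) (hG1 : G 1 = 1) {y : ℝ} (hy : 1 ≤ y) :
    ∫ s, Real.exp (-q * s) * G ((y - 1) * Real.exp (r * s) + 1) ∂expMeasure l = H y := by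
  rw [integral_expMeasure hl]
  set Y : ℝ → ℝ := fun s => (y - 1) * Real.exp (r * s) + 1 with hYdef
  have hY1 : ∀ s, 1 ≤ Y s := fun s => by
    have : 0 ≤ (y - 1) * Real.exp (r * s) := mul_nonneg (by linarith) (Real.exp_pos _).le
    simp only [hYdef]
    linarith
  have hYc : Continuous Y := by fun_prop
  have hderiv : ∀ s, HasDerivAt (fun s => H (Y s)) ((l + q) * H (Y s) - l * G (Y s)) s := by
    intro s
    -- At the critical level the path is constant, and H need not be differentiable there; the
    -- boundary values give the equation instead.
    rcases hy.eq_or_lt with rfl | hy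
    · have hY : ∀ s, Y s = 1 := fun s => by simp [hYdef]
      simp only [hY, hH1, hG1, mul_one, sub_self]
      exact hasDerivAt_const _ _
    · have hYs : 1 < Y s := by
        have : 0 < (y - 1) * Real.exp (r * s) := mul_pos (by linarith) (Real.exp_pos _)
        simp only [hYdef]
        linarith
      obtain ⟨D, hD, hDe⟩ := hH' _ hYs
      have hYd : HasDerivAt Y (r * (Y s - 1)) s := by
        have := ((((hasDerivAt_id s).const_mul r).exp).const_mul (y - 1)).add_const 1
        convert! this using 1
        simp [hYdef]
        ring
      convert! hD.comp s hYd using 1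
      linarith
  have hGYc : Continuous fun s => G (Y s) := hG.comp_continuous hYc hY1
  have heint : IntegrableOn (fun s : ℝ => Real.exp (-(l + q) * s)) (Set.Ioi 0) :=
    exp_neg_integrableOn_Ioi 0 (by linarith)
  -- The equation for H, read along the flow Y' = r(Y - 1), makes the discounted integrand an exact
  -- derivative. Boundedness of H removes the contribution at infinity.
  have hd : ∀ s ∈ Set.Ici (0 : ℝ), HasDerivAt (fun s => -(Real.exp (-(l + q) * s) * H (Y s)))
      (l * Real.exp (-(l * s)) * (Real.exp (-q * s) * G (Y s))) s := by
    intro s _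
    have he : HasDerivAt (fun s : ℝ => Real.exp (-(l + q) * s))
        (Real.exp (-(l + q) * s) * (-(l + q))) s := by
      simpa using ((hasDerivAt_id s).const_mul (-(l + q))).exp
    convert! (he.mul (hderiv s)).neg using 1
    have : Real.exp (-(l + q) * s) = Real.exp (-(l * s)) * Real.exp (-q * s) := by
      rw [← Real.exp_add]; congr 1; ring
    rw [this]
    ring
  have hint : IntegrableOn (fun s => l * Real.exp (-(l * s)) * (Real.exp (-q * s) * G (Y s)))
      (Set.Ioi 0) := by
    have h1 : Integrable (fun s => Real.exp (-(l + q) * s) * G (Y s))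
        (volume.restrict (Set.Ioi 0)) :=
      heint.mul_bdd (c := B) hGYc.aestronglyMeasurable (ae_of_all _ fun s => hGB _ (hY1 s))
    refine (h1.const_mul l).congr (ae_of_all _ fun s => ?_)
    have : Real.exp (-(l + q) * s) = Real.exp (-(l * s)) * Real.exp (-q * s) := by
      rw [← Real.exp_add]; congr 1; ring
    simp only [this]
    ring
  have hlim : Tendsto (fun s => -(Real.exp (-(l + q) * s) * H (Y s))) atTop (𝓝 0) := by
    have h0 : Tendsto (fun s : ℝ => Real.exp (-(l + q) * s)) atTop (𝓝 0) :=
      Real.tendsto_exp_atBot.comp (tendsto_id.const_mul_atTop_of_neg (by linarith))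
    have h1 := bdd_le_mul_tendsto_zero' B (Eventually.of_forall fun s => hHB _ (hY1 s)) h0
    simpa [mul_comm] using h1.neg
  rw [integral_Ioi_of_hasDerivAt_of_tendsto' hd hint hlim]
  simp [hYdef]

theorem growth_eq {r xs s u : ℝ} (hxs : 0 < xs) (hu : xs ≤ u) :
    growth r xs s u = xs * ((u / xs - 1) * Real.exp (r * s) + 1) := by
  rw [growth]
  rcases hu.eq_or_lt with rfl | hu
  · rw [if_neg (lt_irrefl _), div_self hxs.ne']
    simp
  · rw [if_pos hu]
    field_simp

/-- The renewal equation satisfied by the discounted trapping functional. -/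
theorem integral_withTrap_growth {r l q α xs : ℝ} (hl : 0 < l) (hq : 0 ≤ q)
    (hα : 0 < α) (hxs : 0 < xs) {H G : ℝ → ℝ} {B : ℝ}
    (hHB : ∀ y, 1 ≤ y → |H y| ≤ B) (hGB : ∀ y, 1 ≤ y → |G y| ≤ B)
    (hHc : ContinuousOn H (Set.Ici 1)) (hGc : ContinuousOn G (Set.Ici 1))
    (hH' : ∀ y, 1 < y → ∃ D, HasDerivAt H D y ∧ (l + q) * H y - r * (y - 1) * D = l * G y)
    (hG' : ∀ y, 1 < y → HasDerivAt G (α * (H y - G y) / y) y)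
    (hH1 : (l + q) * H 1 = l) (hG1 : G 1 = 1) {u : ℝ} (hu : xs ≤ u) :
    ∫ s, ∫ z, Real.exp (-q * s) * withTrap H (growth r xs s u * z / xs)
      ∂betaMeasure α 1 ∂expMeasure l = withTrap H (u / xs) := by
  have hy : 1 ≤ u / xs := by rwa [le_div_iff₀ hxs, one_mul]
  rw [withTrap, if_neg hy.not_gt, ← integral_exp_growth hl hq hHB hGB hGc hH' hH1 hG1 hy]
  congr 1
  ext s
  rw [integral_const_mul]
  congr 1
  have hY : 1 ≤ (u / xs - 1) * Real.exp (r * s) + 1 := by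
    have : 0 ≤ (u / xs - 1) * Real.exp (r * s) := mul_nonneg (by linarith) (Real.exp_pos _).le
    linarith
  rw [← integral_beta_withTrap hα hHc hGc hG' hG1 hY]
  congr 1
  ext z
  rw [growth_eq hxs hu]
  congr 1
  field_simp

/-! ### The explicit solution of the renewal equation -/

/-- The coefficients of the hypergeometric series attached to the decay exponent `k`; here `L` is
the sum of the loss intensity and of the killing rate. -/
noncomputable def decayCoeff (r L α k : ℝ) (n : ℕ) : ℝ :=
  ordinaryHypergeometricCoefficient k (k + 1 - α) (1 + 2 * k - α + L / r) n

theorem coeff_succ {a b c : ℝ} (hc : 0 < c) (n : ℕ) :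
    (n + 1) * (c + n) * ordinaryHypergeometricCoefficient a b c (n + 1) =
      (a + n) * (b + n) * ordinaryHypergeometricCoefficient a b c n := by
  have h := (ascPochhammer_pos n c hc).ne'
  have hn : c + n ≠ 0 := by positivity
  simp only [ordinaryHypergeometricCoefficient, ascPochhammer_succ_eval, Nat.factorial_succ]
  push_cast
  field_simp

/-- This is the equation yG' = α(H - G) read on coefficients. At n = 0 it is the quadratic equation
`hk`. At n + 1 the factor α - k - n - 1 is -(b + n) with b = k + 1 - α, so the shifted term of
`averageCoeff` is rewritten by the hypergeometric recursion. -/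
theorem averageCoeff_decayCoeff {r l q α k : ℝ} (hr : 0 < r)
    (hk : r * k ^ 2 + k * (l + q - r * α) = q * α) (hc : 0 < 1 + 2 * k - α + (l + q) / r) (n : ℕ) :
    (α - k - n) * averageCoeff (l + q) r k (decayCoeff r (l + q) α k) n =
      α * l * decayCoeff r (l + q) α k n := by
  cases n with
  | zero =>
    have h0 : decayCoeff r (l + q) α k 0 = 1 := by
      simp only [decayCoeff, ordinaryHypergeometricCoefficient, ascPochhammer_zero]
      simp
    rw [averageCoeff, h0]
    push_cast
    linear_combination -hk
  | succ n =>
    have h := coeff_succ (a := k) (b := k + 1 - α) hc n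
    rw [averageCoeff]
    change _ * (_ * decayCoeff r (l + q) α k (n + 1) - _ * decayCoeff r (l + q) α k n) = _
    change (n + 1) * _ * decayCoeff r (l + q) α k (n + 1) = _ * decayCoeff r (l + q) α k n at h
    have h2 : r * (1 + 2 * k - α + (l + q) / r + n) = r * (1 + 2 * k - α + n) + (l + q) := by
      field_simp
      ring
    push_cast
    linear_combination (-r) * h - (decayCoeff r (l + q) α k (n + 1)) * hk +
      ((n + 1) * decayCoeff r (l + q) α k (n + 1)) * h2

theorem summable_decayCoeff {r L α k : ℝ} (hr : 0 < r) (hL : 0 < L)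
    (hc : 0 < 1 + 2 * k - α + L / r) : Summable fun n => |decayCoeff r L α k n| := by
  refine summable_abs_coeff hc ?_
  have : 0 < L / r := by positivity
  linarith

/-- Each of the two terms defining `averageCoeff` carries a factor of order n, but they cancel: the
coefficient relation bounds their difference by l|f n| as soon as n + k - α ≥ α. -/
theorem summable_averageCoeff {r l q α k : ℝ} (hr : 0 < r) (hl : 0 < l) (hq : 0 ≤ q) (hα : 0 < α)
    (hk : r * k ^ 2 + k * (l + q - r * α) = q * α) (hc : 0 < 1 + 2 * k - α + (l + q) / r) :
    Summable fun n => |averageCoeff (l + q) r k (decayCoeff r (l + q) α k) n| := by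
  have hf := summable_decayCoeff hr (by linarith : 0 < l + q) hc
  refine Summable.of_norm_bounded_eventually_nat (hf.mul_left l) ?_
  filter_upwards [tendsto_natCast_atTop_atTop.eventually_ge_atTop (2 * α - k)] with n hn
  have h := congrArg abs (averageCoeff_decayCoeff hr hk hc n)
  rw [abs_mul, abs_mul, abs_of_pos (mul_pos hα hl), abs_of_nonpos (by linarith)] at h
  rw [Real.norm_eq_abs, abs_abs]
  have h2 : α * |averageCoeff (l + q) r k (decayCoeff r (l + q) α k) n| ≤
      -(α - k - n) * |averageCoeff (l + q) r k (decayCoeff r (l + q) α k) n| :=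
    mul_le_mul_of_nonneg_right (by linarith) (abs_nonneg _)
  rw [h, mul_assoc] at h2
  exact le_of_mul_le_mul_left h2 hα

theorem descSeries_decayCoeff (r L α k y : ℝ) : descSeries k (decayCoeff r L α k) y =
    y ^ (-k) * F k (k + 1 - α) (1 + 2 * k - α + L / r) y⁻¹ := by
  rw [descSeries, F_eq_tsum]
  rfl

/-- The explicit Laplace transform above the critical level, as a function of the
capital in units of the critical capital. -/
noncomputable def laplaceSolution (r l q α k y : ℝ) : ℝ :=
  l / (l + q) * (y ^ (-k) * F k (k + 1 - α) (1 + 2 * k - α + (l + q) / r) y⁻¹) /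
    F k (k + 1 - α) (1 + 2 * k - α + (l + q) / r) 1

/-- The explicit solution is bounded, measurable, and solves the renewal equation. -/
theorem laplaceSolution_spec {r l q α k xs : ℝ} (hr : 0 < r) (hl : 0 < l) (hq : 0 ≤ q)
    (hα : 0 < α) (hxs : 0 < xs) (hk0 : 0 ≤ k)
    (hk : r * k ^ 2 + k * (l + q - r * α) = q * α) (hc : 0 < 1 + 2 * k - α + (l + q) / r)
    (hF : F k (k + 1 - α) (1 + 2 * k - α + (l + q) / r) 1 ≠ 0) :
    (∃ B, ∀ t, |withTrap (laplaceSolution r l q α k) t| ≤ B) ∧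
    Measurable (withTrap (laplaceSolution r l q α k)) ∧
    ∀ u, xs ≤ u → ∫ s, ∫ z, Real.exp (-q * s) *
        withTrap (laplaceSolution r l q α k) (growth r xs s u * z / xs)
      ∂betaMeasure α 1 ∂expMeasure l = withTrap (laplaceSolution r l q α k) (u / xs) := by
  have hf := summable_decayCoeff (α := α) (k := k) hr (by linarith : 0 < l + q) hc
  have hg := summable_averageCoeff hr hl hq hα hk hc
  have hrec := averageCoeff_decayCoeff hr hk hc
  set f := decayCoeff r (l + q) α k with hfdef
  set g := averageCoeff (l + q) r k f with hgdef
  set F1 := F k (k + 1 - α) (1 + 2 * k - α + (l + q) / r) 1 with hF1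
  have hlq : l + q ≠ 0 := by positivity
  -- The normalisation is forced by (l + q)H(1) = l. It also gives G(1) = 1, since the series g has
  -- value (l + q)F1 at 1.
  set C := l / (l + q) / F1 with hC
  have hH : laplaceSolution r l q α k = fun y => C * descSeries k f y := by
    ext y
    rw [hfdef, descSeries_decayCoeff, laplaceSolution, hC]
    ring
  have hf1 : descSeries k f 1 = F1 := by
    rw [hfdef, descSeries_decayCoeff, hF1]
    simp
  have hg1 : descSeries k g 1 = (l + q) * F1 := by
    rw [hgdef, descSeries_averageCoeff_one hr.ne' hf hg, hf1]
  have hHc : ContinuousOn (fun y => C * descSeries k f y) (Set.Ici 1) :=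
    continuousOn_const.mul (continuousOn_descSeries hf)
  have hGc : ContinuousOn (fun y => C / l * descSeries k g y) (Set.Ici 1) :=
    continuousOn_const.mul (continuousOn_descSeries hg)
  set B := max (|C| * ∑' n, |f n|) (|C / l| * ∑' n, |g n|) with hB
  have hHB : ∀ y, 1 ≤ y → |C * descSeries k f y| ≤ B := fun y hy => by
    rw [abs_mul]
    exact le_max_of_le_left
      (mul_le_mul_of_nonneg_left (abs_descSeries_le hk0 hf hy) (abs_nonneg _))
  have hGB : ∀ y, 1 ≤ y → |C / l * descSeries k g y| ≤ B := fun y hy => by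
    rw [abs_mul]
    exact le_max_of_le_right
      (mul_le_mul_of_nonneg_left (abs_descSeries_le hk0 hg hy) (abs_nonneg _))
  rw [hH]
  refine ⟨⟨max 1 B, fun t => ?_⟩, ?_, fun u hu => ?_⟩
  · rw [withTrap]
    split_ifs with ht
    · simp
    · exact le_max_of_le_right (hHB t (not_lt.1 ht))
  · have : withTrap (fun y => C * descSeries k f y) =
        (Set.Iio (1 : ℝ)).piecewise (fun _ => 1) (fun y => C * descSeries k f y) := by
      ext t
      simp [withTrap, Set.piecewise]
    rw [this]
    refine ContinuousOn.measurable_piecewise continuousOn_const ?_ measurableSet_Iio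
    rwa [Set.compl_Iio]
  · refine integral_withTrap_growth (G := fun y => C / l * descSeries k g y) hl hq hα hxs hHB hGB
      hHc hGc (fun y hy => ?_) (fun y hy => ?_) ?_ ?_ hu
    · obtain ⟨D, hD, -⟩ := exists_hasDerivAt_descSeries (k := k) hf hy
      refine ⟨C * D, hD.const_mul C, ?_⟩
      have h := sub_mul_deriv_descSeries (L := l + q) (ρ := r) hf hg hy hD
      rw [← hgdef] at h
      rw [← h]
      field_simp
    · obtain ⟨D, hD, hS⟩ := exists_hasDerivAt_descSeries (k := k) hg hy
      have h1 := (((summable_mul_inv_pow hg hy.le).hasSum.mul_left (y ^ (-k))).mul_left α).sub hS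
      have h2 := ((summable_mul_inv_pow hf hy.le).hasSum.mul_left (y ^ (-k))).mul_left (α * l)
      have h3 := h1.unique (h2.congr_fun fun n => by
        linear_combination (y ^ (-k) * y⁻¹ ^ n) * hrec n)
      convert! hD.const_mul (C / l) using 1
      have hy0 : y ≠ 0 := by positivity
      change α * descSeries k g y - -(y * D) = α * l * descSeries k f y at h3
      have hCl : C / l * l = C := by field_simp
      rw [div_eq_iff hy0]
      linear_combination (-(C / l)) * h3 - α * descSeries k f y * hCl
    · simp only [hf1, hC]
      field_simp
    · simp only [hg1, hC]
      field_simp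

/-! ### The trapping time along paths, and discount factors -/

section

theorem lossCount_eq {T : ℕ → ℝ} (hT : StrictMono T) {t : ℝ} {n : ℕ} (h1 : T n ≤ t)
    (h2 : t < T (n + 1)) : lossCount T t = n := by
  have : {m : ℕ | 1 ≤ m ∧ T m ≤ t} = ↑(Finset.Icc 1 n) := by
    ext m
    simp only [Set.mem_ofPred_eq, Finset.coe_Icc, Set.mem_Icc, and_congr_right_iff]
    intro _
    constructor
    · intro h
      by_contra hm
      have := hT.monotone (by omega : n + 1 ≤ m)
      linarith
    · exact fun h => (hT.monotone h).trans h1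
  rw [lossCount, this, Set.ncard_coe_finset, Nat.card_Icc]
  omega

theorem lossTime_lossCount_le {T : ℕ → ℝ} (hT0 : T 0 = 0) (hT : StrictMono T)
    (hlim : Tendsto T atTop atTop) {t : ℝ} (ht : 0 ≤ t) :
    T (lossCount T t) ≤ t := by
  classical
  have hex : ∃ n, t < T n := (hlim.eventually_gt_atTop t).exists
  obtain ⟨m, hm⟩ : ∃ m, Nat.find hex = m + 1 := by
    refine Nat.exists_eq_succ_of_ne_zero fun h => ?_
    have := Nat.find_spec hex
    rw [h, hT0] at this
    linarith
  have h1 : T m ≤ t := not_lt.1 (Nat.find_min hex (by omega))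
  have h2 : t < T (m + 1) := hm ▸ Nat.find_spec hex
  rwa [lossCount_eq hT h1 h2]

/-- Loss-free growth never crosses the critical level, so trapping can occur only at a loss. -/
theorem growth_lt_iff {r xs s u : ℝ} : growth r xs s u < xs ↔ u < xs := by
  rw [growth]
  split_ifs with h
  · have : 0 < (u - xs) * Real.exp (r * s) := mul_pos (by linarith) (Real.exp_pos _)
    constructor <;> intro _ <;> linarith
  · rfl

theorem measurable_growth (r xs : ℝ) : Measurable fun p : ℝ × ℝ => growth r xs p.1 p.2 := by
  unfold growth
  exact Measurable.ite (measurableSet_lt measurable_const measurable_snd) (by fun_prop) (by fun_prop)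

/-- Trapping happens at the first loss after which the capital is below the critical level. -/
theorem trappingTime_eq_iInf {r xs x : ℝ} {T Z : ℕ → ℝ} (hT0 : T 0 = 0) (hT : StrictMono T)
    (hlim : Tendsto T atTop atTop) : trappingTime r xs x T Z =
      ⨅ n, if capitalAtLoss r xs x T Z n < xs then ENNReal.ofReal (T n) else ⊤ := by
  apply le_antisymm
  · refine le_iInf fun n => ?_
    split_ifs with h
    · refine sInf_le ⟨T n, ⟨hT0 ▸ hT.monotone n.zero_le, ?_⟩, rfl⟩
      rw [capital, lossCount_eq hT le_rfl (hT n.lt_succ_self), growth_lt_iff]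
      exact h
    · exact le_top
  · refine le_sInf ?_
    rintro _ ⟨t, ⟨ht0, ht⟩, rfl⟩
    rw [capital, growth_lt_iff] at ht
    refine (iInf_le _ (lossCount T t)).trans ?_
    rw [if_pos ht]
    exact ENNReal.ofReal_le_ofReal (lossTime_lossCount_le hT0 hT hlim ht0)

theorem ofReal_le_trappingTime {r xs x : ℝ} {T Z : ℕ → ℝ} (hT0 : T 0 = 0) (hT : StrictMono T)
    (hlim : Tendsto T atTop atTop) {n : ℕ} (h : ∀ j ≤ n, xs ≤ capitalAtLoss r xs x T Z j) :
    ENNReal.ofReal (T (n + 1)) ≤ trappingTime r xs x T Z := by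
  rw [trappingTime_eq_iInf hT0 hT hlim]
  refine le_iInf fun m => ?_
  split_ifs with hm
  · refine ENNReal.ofReal_le_ofReal (hT.monotone ?_)
    by_contra hlt
    exact (h m (by omega)).not_gt hm
  · exact le_top

theorem trappingTime_eq_ofReal {r xs x : ℝ} {T Z : ℕ → ℝ} (hT0 : T 0 = 0) (hT : StrictMono T)
    (hlim : Tendsto T atTop atTop) {n : ℕ} (h : ∀ j ≤ n, xs ≤ capitalAtLoss r xs x T Z j)
    (hn : capitalAtLoss r xs x T Z (n + 1) < xs) :
    trappingTime r xs x T Z = ENNReal.ofReal (T (n + 1)) := by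
  refine le_antisymm ?_ (ofReal_le_trappingTime hT0 hT hlim h)
  rw [trappingTime_eq_iInf hT0 hT hlim]
  exact (iInf_le _ (n + 1)).trans_eq (if_pos hn)

/-- The discount factor `exp (-q t)` for `t ∈ [0, ∞]`, with value `0` at `∞`. -/
noncomputable def discount (q : ℝ) (t : ENNReal) : ℝ :=
  Set.indicator {t | t < ⊤} (fun t => Real.exp (-q * t.toReal)) t

theorem measurable_discount (q : ℝ) : Measurable (discount q) :=
  Measurable.indicator (by fun_prop) measurableSet_Iio

theorem discount_nonneg (q : ℝ) (t : ENNReal) : 0 ≤ discount q t :=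
  Set.indicator_nonneg (fun _ _ => (Real.exp_pos _).le) _

theorem discount_le_exp {q s : ℝ} (hq : 0 ≤ q) {t : ENNReal} (hs : ENNReal.ofReal s ≤ t) :
    discount q t ≤ Real.exp (-q * s) := by
  refine Set.indicator_apply_le' (fun ht => Real.exp_le_exp.2 ?_) fun _ => (Real.exp_pos _).le
  have : s ≤ t.toReal := (ENNReal.ofReal_le_iff_le_toReal (ne_of_lt ht)).1 hs
  nlinarith

theorem discount_le_one {q : ℝ} (hq : 0 ≤ q) (t : ENNReal) : discount q t ≤ 1 := by
  simpa using discount_le_exp (s := 0) (t := t) hq (by simp)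

theorem discount_ofReal {q s : ℝ} (hs : 0 ≤ s) :
    discount q (ENNReal.ofReal s) = Real.exp (-q * s) := by
  rw [discount, Set.indicator_of_mem (by simp), ENNReal.toReal_ofReal hs]

theorem integral_exp_expMeasure {l q : ℝ} (hl : 0 < l) (hq : 0 ≤ q) :
    ∫ s, Real.exp (-q * s) ∂expMeasure l = l / (l + q) := by
  rw [integral_expMeasure hl]
  have : ∀ s : ℝ, l * Real.exp (-(l * s)) * Real.exp (-q * s) = l * Real.exp (-(l + q) * s) := by
    intro s
    rw [mul_assoc, ← Real.exp_add]
    ring_nf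
  simp_rw [this]
  rw [integral_const_mul, integral_exp_mul_Ioi (by linarith), mul_zero, Real.exp_zero,
    neg_div_neg_eq, mul_one_div]

theorem ae_pos_expMeasure (l : ℝ) : ∀ᵐ s ∂expMeasure l, 0 < s := by
  have hm : Measurable (exponentialPDF l) := (measurable_exponentialPDFReal l).ennreal_ofReal
  have hd : expMeasure l = volume.withDensity (exponentialPDF l) := rfl
  rw [hd, ae_withDensity_iff hm]
  filter_upwards [volume.ae_ne (0 : ℝ)] with s hs h
  by_contra hn
  exact h (exponentialPDF_of_neg (lt_of_le_of_ne (not_lt.1 hn) hs))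

/-- Integration of a function of two independent random elements, the second one having a product
law. -/
theorem integral_comp_indepFun {Ω E A B : Type*} [MeasurableSpace Ω] [MeasurableSpace E]
    [MeasurableSpace A] [MeasurableSpace B] {P : Measure Ω} [IsProbabilityMeasure P]
    {μ : Measure A} {ν : Measure B} [IsProbabilityMeasure μ] [IsProbabilityMeasure ν]
    {V : Ω → E} {U : Ω → A × B} (hV : Measurable V) (hU : Measurable U) (hind : IndepFun V U P)
    (hlaw : P.map U = μ.prod ν) {φ : E × A × B → ℝ} (hφ : Measurable φ)
    (hint : Integrable (fun ω => φ (V ω, U ω)) P) :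
    ∫ ω, φ (V ω, U ω) ∂P = ∫ ω, ∫ s, ∫ z, φ (V ω, s, z) ∂ν ∂μ ∂P := by
  have hmap : P.map (fun ω => (V ω, U ω)) = (P.map V).prod (μ.prod ν) := by
    rw [(indepFun_iff_map_prod_eq_prod_map_map hV.aemeasurable hU.aemeasurable).1 hind, hlaw]
  have hVU : Measurable fun ω => (V ω, U ω) := hV.prodMk hU
  have : IsProbabilityMeasure (P.map V) := Measure.isProbabilityMeasure_map hV.aemeasurable
  have hint' : Integrable φ ((P.map V).prod (μ.prod ν)) := by
    rw [← hmap, integrable_map_measure hφ.aestronglyMeasurable hVU.aemeasurable]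
    exact hint
  rw [← integral_map (f := φ) hVU.aemeasurable hφ.aestronglyMeasurable, hmap,
    integral_prod _ hint', integral_map hV.aemeasurable
      hφ.stronglyMeasurable.integral_prod_right'.aestronglyMeasurable]
  refine integral_congr_ae ?_
  filter_upwards [ae_of_ae_map hV.aemeasurable hint'.prod_right_ae] with ω hω
  exact integral_prod _ hω

/-! ### Histories, independence and almost sure behaviour of the loss times -/

variable {Ω : Type*} {r xs x : ℝ} {T Z : ℕ → Ω → ℝ}

/-- The information available right after the `n`-th loss. -/
@[reducible]
def history (T Z : ℕ → Ω → ℝ) (n : ℕ) : MeasurableSpace Ω :=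
  ⨆ i ∈ {i : ℕ ⊕ ℕ | Sum.elim id id i < n}, MeasurableSpace.comap
    ((Sum.elim (fun n ω => T (n + 1) ω - T n ω) (fun n => Z (n + 1)) : ℕ ⊕ ℕ → Ω → ℝ) i) inferInstance

theorem history_mono {m n : ℕ} (h : m ≤ n) : history T Z m ≤ history T Z n :=
  biSup_mono fun _ hi => lt_of_lt_of_le hi h

theorem measurable_history_interarrival (n : ℕ) :
    Measurable[history T Z (n + 1)] (fun ω => T (n + 1) ω - T n ω) := by
  refine Measurable.mono (comap_measurable _) ?_ le_rfl
  exact le_iSup₂_of_le (Sum.inl n) (by simp) le_rfl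

theorem measurable_history_proportion (n : ℕ) :
    Measurable[history T Z (n + 1)] (Z (n + 1)) := by
  refine Measurable.mono (comap_measurable _) ?_ le_rfl
  exact le_iSup₂_of_le (Sum.inr n) (by simp) le_rfl

theorem measurable_history_capital (n : ℕ) :
    Measurable[history T Z n]
      (fun ω => capitalAtLoss r xs x (fun n => T n ω) (fun n => Z n ω) n) := by
  induction n with
  | zero => exact measurable_const
  | succ n ih =>
    exact ((measurable_growth r xs).comp ((measurable_history_interarrival n).prodMk
      (ih.mono (history_mono n.le_succ) le_rfl))).mul (measurable_history_proportion n)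

variable [MeasurableSpace Ω] {P : Measure Ω} {lam α : ℝ}

theorem measurable_history_T (h : IsLossModel P lam α T Z) (n : ℕ) :
    Measurable[history T Z n] (T n) := by
  induction n with
  | zero =>
    have : T 0 = fun _ => 0 := funext h.T_zero
    rw [this]
    exact measurable_const
  | succ n ih =>
    have h1 := (ih.mono (history_mono n.le_succ) le_rfl).add (measurable_history_interarrival n)
    convert! h1 using 1
    ext ω
    simp

theorem IsLossModel.measurable_input (h : IsLossModel P lam α T Z) (i : ℕ ⊕ ℕ) :
    Measurable ((Sum.elim (fun n ω => T (n + 1) ω - T n ω) (fun n => Z (n + 1)) :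
      ℕ ⊕ ℕ → Ω → ℝ) i) := by
  rcases i with n | n
  · exact (h.measurable_T (n + 1)).sub (h.measurable_T n)
  · exact h.measurable_Z (n + 1)

theorem IsLossModel.history_le (h : IsLossModel P lam α T Z) (n : ℕ) :
    history T Z n ≤ ‹MeasurableSpace Ω› :=
  iSup₂_le fun i _ => (h.measurable_input i).comap_le

/-- The history up to the `n`-th loss is independent of the next inter-arrival time and remaining
proportion. -/
theorem IsLossModel.indepFun_history (h : IsLossModel P lam α T Z) {E : Type*} [MeasurableSpace E]
    {n : ℕ} {V : Ω → E} (hV : Measurable[history T Z n] V) :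
    IndepFun V (fun ω => (T (n + 1) ω - T n ω, Z (n + 1) ω)) P := by
  have hd : Disjoint {i : ℕ ⊕ ℕ | Sum.elim id id i < n} {i : ℕ ⊕ ℕ | Sum.elim id id i = n} :=
    Set.disjoint_left.2 fun i hi hi' => (ne_of_lt hi) hi'
  have hind := indep_iSup_of_disjoint (fun i => (h.measurable_input i).comap_le) h.indep hd
  rw [IndepFun_iff_Indep]
  refine indep_of_indep_of_le_left (indep_of_indep_of_le_right hind ?_) hV.comap_le
  refine Measurable.comap_le (Measurable.prodMk ?_ ?_)
  · refine Measurable.mono (comap_measurable _) ?_ le_rfl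
    exact le_iSup₂_of_le (Sum.inl n) (by simp) le_rfl
  · refine Measurable.mono (comap_measurable _) ?_ le_rfl
    exact le_iSup₂_of_le (Sum.inr n) (by simp) le_rfl

theorem IsLossModel.ae_strictMono (h : IsLossModel P lam α T Z) :
    ∀ᵐ ω ∂P, StrictMono fun n => T n ω := by
  have : ∀ᵐ ω ∂P, ∀ n, 0 < T (n + 1) ω - T n ω := by
    refine ae_all_iff.2 fun n => ?_
    refine ae_of_ae_map (h.measurable_input (Sum.inl n)).aemeasurable (p := fun s => 0 < s) ?_
    exact (h.law_interarrival n).symm ▸ ae_pos_expMeasure lam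
  filter_upwards [this] with ω hω
  exact strictMono_nat_of_lt_succ fun n => sub_pos.1 (hω n)

theorem IsLossModel.ae_nonneg (h : IsLossModel P lam α T Z) : ∀ᵐ ω ∂P, ∀ n, 0 ≤ T n ω := by
  filter_upwards [h.ae_strictMono] with ω hω n
  rw [← h.T_zero ω]
  exact hω.monotone n.zero_le

variable [IsProbabilityMeasure P]

theorem IsLossModel.law_pair (h : IsLossModel P lam α T Z) (n : ℕ) :
    P.map (fun ω => (T (n + 1) ω - T n ω, Z (n + 1) ω)) =
      (expMeasure lam).prod (betaMeasure α 1) := by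
  have hind := h.indep.indepFun (i := Sum.inl n) (j := Sum.inr n) (by simp)
  have := (indepFun_iff_map_prod_eq_prod_map_map (h.measurable_input _).aemeasurable
    (h.measurable_input _).aemeasurable).1 hind
  simpa [h.law_interarrival n, h.law_Z n] using this

theorem IsLossModel.integrable_exp (h : IsLossModel P lam α T Z) {q : ℝ} (hq : 0 ≤ q) (n : ℕ) :
    Integrable (fun ω => Real.exp (-q * T n ω)) P := by
  have hm := h.measurable_T n
  refine Integrable.of_bound (C := 1) (by fun_prop) ?_
  filter_upwards [h.ae_nonneg] with ω hω
  rw [Real.norm_eq_abs, Real.abs_exp, Real.exp_le_one_iff]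
  nlinarith [hω n]

theorem IsLossModel.integral_exp (h : IsLossModel P lam α T Z) (hlam : 0 < lam) {q : ℝ}
    (hq : 0 ≤ q) (n : ℕ) : ∫ ω, Real.exp (-q * T n ω) ∂P = (lam / (lam + q)) ^ n := by
  induction n with
  | zero => simp [h.T_zero]
  | succ n ih =>
    have hind := (h.indepFun_history (measurable_history_T h n)).comp
      (φ := fun t => Real.exp (-q * t)) (ψ := fun p : ℝ × ℝ => Real.exp (-q * p.1))
      (by fun_prop) (by fun_prop)
    have hm := h.measurable_T n
    have hm' := h.measurable_T (n + 1)
    have hmul := hind.integral_mul_eq_mul_integral (by fun_prop) (by fun_prop)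
    have e1 : ∀ ω, Real.exp (-q * T (n + 1) ω) =
        Real.exp (-q * T n ω) * Real.exp (-q * (T (n + 1) ω - T n ω)) := by
      intro ω
      rw [← Real.exp_add]
      ring_nf
    have hD : AEMeasurable (fun ω => T (n + 1) ω - T n ω) P := (hm'.sub hm).aemeasurable
    have e2 : ∫ ω, Real.exp (-q * (T (n + 1) ω - T n ω)) ∂P = lam / (lam + q) := by
      rw [← integral_exp_expMeasure hlam hq, ← h.law_interarrival n,
        integral_map hD (by fun_prop)]
    simp_rw [e1]
    rw [pow_succ, ← ih, ← e2]
    exact hmul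

/-- The expectations of exp(-T n) form a convergent geometric series, so almost surely ∑ exp(-T n)
is finite and its terms tend to 0. -/
theorem IsLossModel.ae_tendsto (h : IsLossModel P lam α T Z) (hlam : 0 < lam) :
    ∀ᵐ ω ∂P, Tendsto (fun n => T n ω) atTop atTop := by
  have hm := h.measurable_T
  have hfin : ∫⁻ ω, ∑' n, ENNReal.ofReal (Real.exp (-1 * T n ω)) ∂P ≠ ⊤ := by
    rw [lintegral_tsum fun n => by fun_prop]
    have : ∀ n, ∫⁻ ω, ENNReal.ofReal (Real.exp (-1 * T n ω)) ∂P =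
        ENNReal.ofReal ((lam / (lam + 1)) ^ n) := fun n => by
      rw [← h.integral_exp hlam zero_le_one, ofReal_integral_eq_lintegral_ofReal
        (h.integrable_exp zero_le_one n) (ae_of_all _ fun _ => (Real.exp_pos _).le)]
    simp_rw [this]
    refine (Summable.tsum_ofReal_ne_top (summable_geometric_of_lt_one (by positivity) ?_))
    rw [div_lt_one (by positivity)]
    linarith
  filter_upwards [ae_lt_top' (by fun_prop) hfin] with ω hω
  have h0 := ENNReal.tendsto_atTop_zero_of_tsum_ne_top hω.ne
  have h1 := (ENNReal.tendsto_toReal ENNReal.zero_ne_top).comp h0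
  have h2 : Tendsto (fun n => Real.exp (-1 * T n ω)) atTop (𝓝 0) := by
    refine h1.congr fun n => ?_
    simp [(Real.exp_pos _).le]
  have h3 := tendsto_neg_atBot_atTop.comp (Real.tendsto_exp_comp_nhds_zero.1 h2)
  refine h3.congr fun n => ?_
  simp

/-- The defining infimum runs over uncountably many times; almost surely it equals a countable
infimum over the losses. The null set of irregular paths is why only a.e. measurability is claimed.
-/
theorem IsLossModel.aemeasurable_trappingTime (h : IsLossModel P lam α T Z) (hlam : 0 < lam) :
    AEMeasurable (fun ω => trappingTime r xs x (fun n => T n ω) (fun n => Z n ω)) P := by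
  refine ⟨fun ω => ⨅ n, if capitalAtLoss r xs x (fun n => T n ω) (fun n => Z n ω) n < xs then
    ENNReal.ofReal (T n ω) else ⊤, ?_, ?_⟩
  · refine Measurable.iInf fun n => Measurable.ite ?_ (h.measurable_T n).ennreal_ofReal
      measurable_const
    exact measurableSet_lt ((measurable_history_capital n).mono (h.history_le n) le_rfl)
      measurable_const
  · filter_upwards [h.ae_strictMono, h.ae_tendsto hlam] with ω h1 h2
    exact trappingTime_eq_iInf (h.T_zero ω) h1 h2

end

/-! ### The renewal argument: bounded solutions are the Laplace transform -/

section

variable {Ω : Type*} {r xs x : ℝ} {T Z : ℕ → Ω → ℝ}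

/-- The event that the capital is not below the critical level after each of the first `n`
losses. -/
def survival (r xs x : ℝ) (T Z : ℕ → Ω → ℝ) (n : ℕ) : Set Ω :=
  {ω | ∀ j ≤ n, xs ≤ capitalAtLoss r xs x (fun n => T n ω) (fun n => Z n ω) j}

theorem measurableSet_survival (n : ℕ) :
    MeasurableSet[history T Z n] (survival r xs x T Z n) := by
  have : survival r xs x T Z n = ⋂ j ∈ Set.Iic n,
      {ω | xs ≤ capitalAtLoss r xs x (fun n => T n ω) (fun n => Z n ω) j} := by
    ext ω
    simp [survival]
  rw [this]
  refine MeasurableSet.biInter (Set.to_countable _) fun j hj => ?_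
  exact measurableSet_le measurable_const
    ((measurable_history_capital j).mono (history_mono hj) le_rfl)

variable [MeasurableSpace Ω] {P : Measure Ω} [IsProbabilityMeasure P] {lam α : ℝ}

/-- One step of the renewal argument. -/
theorem IsLossModel.integral_survival_step (h : IsLossModel P lam α T Z) (hlam : 0 < lam)
    (hα : 0 < α) {q B : ℝ} (hq : 0 ≤ q) {g : ℝ → ℝ} (hg : Measurable g) (hB : ∀ u, |g u| ≤ B)
    (hren : ∀ u, xs ≤ u → ∫ s, ∫ z, Real.exp (-q * s) * g (growth r xs s u * z)
      ∂betaMeasure α 1 ∂expMeasure lam = g u) (n : ℕ) :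
    ∫ ω, (survival r xs x T Z n).indicator (fun ω => Real.exp (-q * T (n + 1) ω) *
      g (capitalAtLoss r xs x (fun n => T n ω) (fun n => Z n ω) (n + 1))) ω ∂P =
    ∫ ω, (survival r xs x T Z n).indicator (fun ω => Real.exp (-q * T n ω) *
      g (capitalAtLoss r xs x (fun n => T n ω) (fun n => Z n ω) n)) ω ∂P := by
  classical
  have := isProbabilityMeasure_expMeasure hlam
  have := isProbabilityMeasureBeta hα one_pos
  set X : ℕ → Ω → ℝ := fun n ω => capitalAtLoss r xs x (fun n => T n ω) (fun n => Z n ω) n with hX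
  set w : Ω → ℝ := (survival r xs x T Z n).indicator fun ω => Real.exp (-q * T n ω) with hw
  have hXm : Measurable[history T Z n] (X n) := measurable_history_capital n
  have hwm : Measurable[history T Z n] w :=
    Measurable.indicator (Real.measurable_exp.comp ((measurable_history_T h n).const_mul (-q)))
      (measurableSet_survival n)
  -- The integrand splits into the pair (w, X n), known after loss n, and the independent next
  -- waiting time and proportion. Integrating out the latter is the renewal equation, available
  -- because X n ≥ xs where w ≠ 0.
  set φ : (ℝ × ℝ) × ℝ × ℝ → ℝ := fun p =>
    p.1.1 * (Real.exp (-q * p.2.1) * g (growth r xs p.2.1 p.1.2 * p.2.2)) with hφ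
  have hφm : Measurable φ := by
    have hgr : Measurable fun p : (ℝ × ℝ) × ℝ × ℝ => growth r xs p.2.1 p.1.2 :=
      (measurable_growth r xs).comp (f := fun p : (ℝ × ℝ) × ℝ × ℝ => (p.2.1, p.1.2)) (by fun_prop)
    fun_prop
  have e1 : ∀ ω, (survival r xs x T Z n).indicator (fun ω => Real.exp (-q * T (n + 1) ω) *
      g (X (n + 1) ω)) ω = φ ((w ω, X n ω), (T (n + 1) ω - T n ω, Z (n + 1) ω)) := by
    intro ω
    simp only [hφ, hw, Set.indicator_apply]
    split_ifs
    · rw [← mul_assoc, ← Real.exp_add]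
      congr 2
      ring
    · simp
  have hUm : Measurable fun ω => (T (n + 1) ω - T n ω, Z (n + 1) ω) :=
    (h.measurable_input (Sum.inl n)).prodMk (h.measurable_Z (n + 1))
  have hmeas1 : Measurable fun ω => φ ((w ω, X n ω), (T (n + 1) ω - T n ω, Z (n + 1) ω)) :=
    hφm.comp (((hwm.prodMk hXm).mono (h.history_le n) le_rfl).prodMk hUm)
  have hint : Integrable
      (fun ω => φ ((w ω, X n ω), (T (n + 1) ω - T n ω, Z (n + 1) ω))) P := by
    refine ((h.integrable_exp hq (n + 1)).mul_const B).mono' hmeas1.aestronglyMeasurable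
      (ae_of_all _ fun ω => ?_)
    rw [← e1, Set.indicator_apply]
    have hB0 : 0 ≤ B := (abs_nonneg _).trans (hB 0)
    split_ifs
    · rw [Real.norm_eq_abs, abs_mul, Real.abs_exp]
      exact mul_le_mul_of_nonneg_left (hB _) (Real.exp_pos _).le
    · rw [norm_zero]
      positivity
  change ∫ ω, (survival r xs x T Z n).indicator (fun ω => Real.exp (-q * T (n + 1) ω) *
      g (X (n + 1) ω)) ω ∂P = _
  simp_rw [e1]
  rw [integral_comp_indepFun (V := fun ω => (w ω, X n ω))
    ((hwm.prodMk hXm).mono (h.history_le n) le_rfl)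
    hUm
    (h.indepFun_history (hwm.prodMk hXm)) (h.law_pair n) hφm hint]
  congr 1
  ext ω
  simp only [hφ, hw, Set.indicator_apply]
  split_ifs with hω
  · simp_rw [integral_const_mul (Real.exp (-q * T n ω))]
    rw [hren _ (hω n le_rfl)]
  · simp

/-- The Laplace transform of the trapping time is the bounded solution of the renewal equation. -/
theorem IsLossModel.integral_discount_trappingTime (h : IsLossModel P lam α T Z) (hlam : 0 < lam)
    (hα : 0 < α) (hx : xs ≤ x) {q B : ℝ} (hq : 0 < q) {g : ℝ → ℝ} (hg : Measurable g)
    (hB : ∀ u, |g u| ≤ B) (hg1 : ∀ u, u < xs → g u = 1)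
    (hren : ∀ u, xs ≤ u → ∫ s, ∫ z, Real.exp (-q * s) * g (growth r xs s u * z)
      ∂betaMeasure α 1 ∂expMeasure lam = g u) :
    ∫ ω, discount q (trappingTime r xs x (fun n => T n ω) (fun n => Z n ω)) ∂P = g x := by
  set X : ℕ → Ω → ℝ := fun n ω => capitalAtLoss r xs x (fun n => T n ω) (fun n => Z n ω) n with hX
  set A : ℕ → Set Ω := survival r xs x T Z with hA
  set D : Ω → ℝ := fun ω =>
    discount q (trappingTime r xs x (fun n => T n ω) (fun n => Z n ω)) with hD
  have hXm : ∀ n, Measurable (X n) := fun n =>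
    (measurable_history_capital n).mono (h.history_le n) le_rfl
  have hAm : ∀ n, MeasurableSet (A n) := fun n => h.history_le n _ (measurableSet_survival n)
  have hB0 : 0 ≤ B := (abs_nonneg _).trans (hB 0)
  have hDi : Integrable D P := by
    refine Integrable.of_bound (C := 1) ((measurable_discount q).comp_aemeasurable
      (h.aemeasurable_trappingTime hlam)).aestronglyMeasurable (ae_of_all _ fun ω => ?_)
    rw [Real.norm_eq_abs, abs_of_nonneg (discount_nonneg _ _)]
    exact discount_le_one hq.le _
  have hEi : ∀ m n, Integrable (fun ω => Real.exp (-q * T m ω) * g (X n ω)) P := fun m n =>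
    (h.integrable_exp hq.le m).mul_bdd (c := B) (hg.comp (hXm n)).aestronglyMeasurable
      (ae_of_all _ fun ω => hB _)
  -- An invariant in n: surviving paths carry the discounted solution, trapped paths their actual
  -- discount. A path trapped at loss n + 1 passes from one term to the other without a change of
  -- value, because g = 1 below the critical level.
  have hstep : ∀ n, ∫ ω, (A n).indicator (fun ω => Real.exp (-q * T n ω) * g (X n ω)) ω +
      (A n)ᶜ.indicator D ω ∂P = g x := by
    intro n
    induction n with
    | zero =>
      have : ∀ ω, (A 0).indicator (fun ω => Real.exp (-q * T 0 ω) * g (X 0 ω)) ω +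
          (A 0)ᶜ.indicator D ω = g x := by
        intro ω
        have hω : ω ∈ A 0 := by
          intro j hj
          rw [Nat.le_zero.1 hj]
          exact hx
        rw [Set.indicator_of_mem hω, Set.indicator_of_notMem (by simpa using hω)]
        simp [h.T_zero, hX, capitalAtLoss]
      simp_rw [this]
      simp
    | succ n ih =>
      rw [← ih]
      rw [integral_add ((hEi n n).indicator (hAm n)) (hDi.indicator (hAm n).compl),
        ← h.integral_survival_step hlam hα hq.le hg hB hren n,
        ← integral_add ((hEi (n + 1) (n + 1)).indicator (hAm n)) (hDi.indicator (hAm n).compl)]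
      refine integral_congr_ae ?_
      filter_upwards [h.ae_strictMono, h.ae_tendsto hlam, h.ae_nonneg] with ω h1 h2 h3
      by_cases hω : ω ∈ A n
      · rw [Set.indicator_of_mem (s := A n) hω,
          Set.indicator_of_notMem (s := (A n)ᶜ) (by simpa using hω)]
        by_cases hω' : xs ≤ X (n + 1) ω
        · have hω1 : ω ∈ A (n + 1) := by
            intro j hj
            rcases Nat.le_succ_iff.1 hj with hj | rfl
            · exact hω j hj
            · exact hω'
          rw [Set.indicator_of_mem hω1, Set.indicator_of_notMem (by simpa using hω1)]
        · have hω1 : ω ∉ A (n + 1) := fun hmem => hω' (hmem (n + 1) le_rfl)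
          rw [Set.indicator_of_notMem hω1, Set.indicator_of_mem (by simpa using hω1)]
          change 0 + D ω = Real.exp (-q * T (n + 1) ω) * g (X (n + 1) ω) + 0
          rw [hg1 _ (not_le.1 hω'), hD]
          simp only
          rw [trappingTime_eq_ofReal (h.T_zero ω) h1 h2 hω (not_le.1 hω'),
            discount_ofReal (h3 _)]
          ring
      · have hω1 : ω ∉ A (n + 1) := fun hmem => hω fun j hj => hmem j (by omega)
        rw [Set.indicator_of_notMem hω1, Set.indicator_of_mem (by simpa using hω1),
          Set.indicator_of_notMem (s := A n) hω,
          Set.indicator_of_mem (s := (A n)ᶜ) (by simpa using hω)]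
  -- The two integrands differ only on survival up to loss n. There trapping comes after T n, so D
  -- is at most exp(-q T n), and the other term is at most B times that.
  have hbound : ∀ n, |(∫ ω, D ω ∂P) - g x| ≤ (1 + B) * (lam / (lam + q)) ^ n := by
    intro n
    have hint := ((hEi n n).indicator (hAm n)).add (hDi.indicator (hAm n).compl)
    rw [← hstep n, ← h.integral_exp hlam hq.le n, ← integral_const_mul]
    have hsub := integral_sub hDi hint
    simp only [Pi.add_apply] at hsub
    rw [← hsub, ← Real.norm_eq_abs]
    refine norm_integral_le_of_norm_le ((h.integrable_exp hq.le n).const_mul _) ?_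
    filter_upwards [h.ae_strictMono, h.ae_tendsto hlam, h.ae_nonneg] with ω h1 h2 h3
    by_cases hω : ω ∈ A n
    · rw [Set.indicator_of_mem (s := A n) hω,
          Set.indicator_of_notMem (s := (A n)ᶜ) (by simpa using hω),
        add_zero, Real.norm_eq_abs]
      have hD1 : D ω ≤ Real.exp (-q * T n ω) := discount_le_exp hq.le
        ((ENNReal.ofReal_le_ofReal (h1 n.lt_succ_self).le).trans
          (ofReal_le_trappingTime (h.T_zero ω) h1 h2 hω))
      have hD0 : 0 ≤ D ω := discount_nonneg _ _
      refine (abs_sub _ _).trans ?_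
      rw [abs_of_nonneg hD0, abs_mul, Real.abs_exp]
      have := mul_le_mul_of_nonneg_left (hB (X n ω)) (Real.exp_pos (-q * T n ω)).le
      linarith
    · rw [Set.indicator_of_notMem (s := A n) hω,
          Set.indicator_of_mem (s := (A n)ᶜ) (by simpa using hω),
        zero_add, sub_self, norm_zero]
      positivity
  have hlim : Tendsto (fun n => (1 + B) * (lam / (lam + q)) ^ n) atTop (𝓝 0) := by
    have := (tendsto_pow_atTop_nhds_zero_of_lt_one (r := lam / (lam + q)) (by positivity)
      (by rw [div_lt_one (by positivity)]; linarith)).const_mul (1 + B)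
    rwa [mul_zero] at this
  have h0 : |(∫ ω, D ω ∂P) - g x| ≤ 0 := ge_of_tendsto' hlim hbound
  exact sub_eq_zero.1 (abs_nonpos_iff.1 h0)

/-- The Laplace transform of the trapping time, for a positive killing rate. -/
theorem IsLossModel.trappingLaplace_eq (h : IsLossModel P lam α T Z) (hlam : 0 < lam) (hr : 0 < r)
    (hα : 0 < α) (hxs : 0 < xs) (hx : xs ≤ x) {q k : ℝ} (hq : 0 < q) (hk0 : 0 ≤ k)
    (hk : r * k ^ 2 + k * (lam + q - r * α) = q * α)
    (hc : 0 < 1 + 2 * k - α + (lam + q) / r)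
    (hF : F k (k + 1 - α) (1 + 2 * k - α + (lam + q) / r) 1 ≠ 0) :
    trappingLaplace P r xs x T Z q = laplaceSolution r lam q α k (x / xs) := by
  obtain ⟨⟨B, hB⟩, hm, hren⟩ := laplaceSolution_spec hr hlam hq.le hα hxs hk0 hk hc hF
  have key := h.integral_discount_trappingTime hlam hα hx hq
    (g := fun u => withTrap (laplaceSolution r lam q α k) (u / xs)) (hm.comp (by fun_prop))
    (fun u => hB _) (fun u hu => by rw [withTrap, if_pos ((div_lt_one hxs).2 hu)]) hren
  have hy : 1 ≤ x / xs := by rwa [le_div_iff₀ hxs, one_mul]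
  simp only [withTrap, if_neg hy.not_gt] at key
  exact key

end

/-! ### From the Laplace transform near zero to the mean -/

theorem tendsto_discount_quotient (t : ENNReal) :
    Tendsto (fun q => (discount 0 t - discount q t) / q) (𝓝[>] 0) (𝓝 t.toReal) := by
  by_cases ht : t < ⊤
  · have h1 : HasDerivAt (fun q : ℝ => Real.exp (-q * t.toReal)) (-t.toReal) 0 := by
      simpa using ((hasDerivAt_id (0 : ℝ)).neg.mul_const t.toReal).exp
    have h2 := (hasDerivAt_iff_tendsto_slope.1 h1).mono_left
      (nhdsWithin_mono 0 fun q (hq : 0 < q) => hq.ne')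
    have h3 := h2.neg
    rw [neg_neg] at h3
    refine h3.congr fun q => ?_
    simp only [slope, discount, Set.indicator_of_mem (show t ∈ {t : ENNReal | t < ⊤} from ht),
      vsub_eq_sub, smul_eq_mul, sub_zero]
    ring
  -- At infinity all discounts vanish, even for q = 0, and `toReal` is 0, so both sides are 0.
  · have : t = ⊤ := not_lt_top_iff.1 ht
    simp [this, discount]

theorem discount_quotient_nonneg {q : ℝ} (hq : 0 < q) (t : ENNReal) :
    0 ≤ (discount 0 t - discount q t) / q := by
  refine div_nonneg (sub_nonneg.2 ?_) hq.le
  by_cases ht : t < ⊤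
  · simp only [discount, Set.indicator_of_mem (show t ∈ {t : ENNReal | t < ⊤} from ht)]
    refine Real.exp_le_exp.2 ?_
    have := t.toReal_nonneg
    nlinarith
  · simp [discount, ht]

theorem discount_quotient_le {q : ℝ} (hq : 0 < q) (t : ENNReal) :
    (discount 0 t - discount q t) / q ≤ t.toReal := by
  rw [div_le_iff₀ hq, discount, discount]
  by_cases ht : t < ⊤
  · simp only [Set.indicator_of_mem (show t ∈ {t : ENNReal | t < ⊤} from ht)]
    have := Real.add_one_le_exp (-q * t.toReal)
    simp only [neg_zero, zero_mul, Real.exp_zero]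
    linarith
  · simp only [Set.indicator_of_notMem (show t ∉ {t : ENNReal | t < ⊤} from ht), sub_self]
    have := t.toReal_nonneg
    positivity

/-- If the Laplace transform of a `[0, ∞]`-valued random variable agrees, for small positive
arguments, with a function differentiable at `0`, then its mean on the event of finiteness is
minus the derivative. -/
theorem integrable_toReal_of_laplace {Ω : Type*} [MeasurableSpace Ω] {P : Measure Ω}
    [IsProbabilityMeasure P] {τ : Ω → ENNReal} (hτ : AEMeasurable τ P) {H : ℝ → ℝ} {H' : ℝ}
    (hH : HasDerivAt H H' 0) (heq : ∀ᶠ q in 𝓝[>] 0, ∫ ω, discount q (τ ω) ∂P = H q) :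
    Integrable (fun ω => (τ ω).toReal) P ∧
    HasDerivWithinAt (fun q => ∫ ω, discount q (τ ω) ∂P) (-∫ ω, (τ ω).toReal ∂P) (Set.Ici 0) 0 ∧
    ∫ ω, (τ ω).toReal ∂P = -H' := by
  have hm : ∀ q, AEStronglyMeasurable (fun ω => discount q (τ ω)) P := fun q =>
    ((measurable_discount q).comp_aemeasurable hτ).aestronglyMeasurable
  have hi : ∀ q, 0 ≤ q → Integrable (fun ω => discount q (τ ω)) P := fun q hq =>
    Integrable.of_bound (C := 1) (hm q) (ae_of_all _ fun ω => by
      rw [Real.norm_eq_abs, abs_of_nonneg (discount_nonneg _ _)]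
      exact discount_le_one hq _)
  have hpos : ∀ᶠ q : ℝ in 𝓝[>] 0, 0 < q := self_mem_nhdsWithin
  have hlim0 : Tendsto (fun q => ∫ ω, discount q (τ ω) ∂P) (𝓝[>] 0)
      (𝓝 (∫ ω, discount 0 (τ ω) ∂P)) := by
    refine tendsto_integral_filter_of_dominated_convergence (fun _ => 1)
      (Eventually.of_forall hm) ?_ (integrable_const _) (ae_of_all _ fun ω => ?_)
    · filter_upwards [hpos] with q hq
      refine ae_of_all _ fun ω => ?_
      rw [Real.norm_eq_abs, abs_of_nonneg (discount_nonneg _ _)]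
      exact discount_le_one hq.le _
    · by_cases ht : τ ω < ⊤
      · simp only [discount, Set.indicator_of_mem (show τ ω ∈ {t : ENNReal | t < ⊤} from ht)]
        have : Continuous fun q : ℝ => Real.exp (-q * (τ ω).toReal) := by fun_prop
        exact (this.tendsto 0).mono_left nhdsWithin_le_nhds
      · simp [discount, ht]
  -- The agreement with H is assumed only for q > 0; it extends to 0 since both sides are continuous
  -- from the right.
  have h0 : ∫ ω, discount 0 (τ ω) ∂P = H 0 :=
    tendsto_nhds_unique (hlim0.congr' heq) (hH.continuousAt.mono_left nhdsWithin_le_nhds)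
  have hquot : Tendsto (fun q => ∫ ω, (discount 0 (τ ω) - discount q (τ ω)) / q ∂P) (𝓝[>] 0)
      (𝓝 (-H')) := by
    have h2 := ((hasDerivAt_iff_tendsto_slope.1 hH).mono_left
      (nhdsWithin_mono 0 fun q (hq : 0 < q) => hq.ne')).neg
    refine h2.congr' ?_
    filter_upwards [heq, hpos] with q hq hq0
    rw [integral_div, integral_sub (hi 0 le_rfl) (hi q hq0.le), h0, hq, slope, vsub_eq_sub,
      smul_eq_mul, sub_zero]
    ring
  have hint : Integrable (fun ω => (τ ω).toReal) P := by
    refine ⟨hτ.ennreal_toReal.aestronglyMeasurable, ?_⟩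
    rw [hasFiniteIntegral_iff_ofReal (ae_of_all _ fun _ => ENNReal.toReal_nonneg)]
    obtain ⟨u, hu⟩ := exists_seq_tendsto (𝓝[>] (0 : ℝ))
    -- Fatou's lemma on the nonnegative quotients comes first: it yields integrability of `toReal`,
    -- which then serves as the dominating function for the exact value.
    have hfat := lintegral_liminf_le' (μ := P) (u := atTop)
      (f := fun n ω => ENNReal.ofReal ((discount 0 (τ ω) - discount (u n) (τ ω)) / u n))
      (fun n => (((hm 0).sub (hm (u n))).aemeasurable.div_const _).ennreal_ofReal)
    have e1 : ∀ ω, liminf (fun n => ENNReal.ofReal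
        ((discount 0 (τ ω) - discount (u n) (τ ω)) / u n)) atTop =
        ENNReal.ofReal (τ ω).toReal := fun ω =>
      (ENNReal.tendsto_ofReal ((tendsto_discount_quotient (τ ω)).comp hu)).liminf_eq
    simp_rw [e1] at hfat
    refine hfat.trans_lt ?_
    have e2 : Tendsto (fun n => ∫⁻ ω, ENNReal.ofReal
        ((discount 0 (τ ω) - discount (u n) (τ ω)) / u n) ∂P) atTop (𝓝 (ENNReal.ofReal (-H'))) := by
      refine (ENNReal.tendsto_ofReal (hquot.comp hu)).congr' ?_
      filter_upwards [hu.eventually hpos] with n hn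
      exact ofReal_integral_eq_lintegral_ofReal (((hi 0 le_rfl).sub (hi _ hn.le)).div_const _)
        (ae_of_all _ fun ω => discount_quotient_nonneg hn _)
    rw [e2.liminf_eq]
    exact ENNReal.ofReal_lt_top
  have hval : ∫ ω, (τ ω).toReal ∂P = -H' := by
    refine tendsto_nhds_unique ?_ hquot
    refine tendsto_integral_filter_of_dominated_convergence (fun ω => (τ ω).toReal)
      (Eventually.of_forall fun q =>
        (((hm 0).sub (hm q)).aemeasurable.div_const _).aestronglyMeasurable) ?_ hint
      (ae_of_all _ fun ω => tendsto_discount_quotient (τ ω))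
    filter_upwards [hpos] with q hq
    refine ae_of_all _ fun ω => ?_
    rw [Real.norm_eq_abs, abs_of_nonneg (discount_quotient_nonneg hq _)]
    exact discount_quotient_le hq _
  refine ⟨hint, ?_, hval⟩
  rw [hval, neg_neg]
  refine hH.hasDerivWithinAt.congr_of_eventuallyEq ?_ h0
  rw [← Set.Ioi_insert, nhdsWithin_insert]
  exact eventually_sup.2 ⟨h0, heq⟩

/-! ### Differentiating the explicit formula at killing rate zero -/

/-- The decay exponent at killing rate `q`: the nonnegative root of
`r k² + k (l + q - r α) = q α`. -/
noncomputable def decayExponent (r l α q : ℝ) : ℝ :=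
  ((r * α - l - q) + Real.sqrt ((r * α - l - q) ^ 2 + 4 * r * α * q)) / (2 * r)

theorem decayExponent_spec {r l α q : ℝ} (hr : 0 < r) (hα : 0 < α) (hq : 0 ≤ q) :
    0 ≤ decayExponent r l α q ∧
    r * decayExponent r l α q ^ 2 + decayExponent r l α q * (l + q - r * α) = q * α := by
  have hnn : 0 ≤ (r * α - l - q) ^ 2 + 4 * r * α * q := by positivity
  have hs := Real.sq_sqrt hnn
  have habs : |r * α - l - q| ≤ Real.sqrt ((r * α - l - q) ^ 2 + 4 * r * α * q) :=
    Real.abs_le_sqrt (by nlinarith [mul_nonneg (mul_pos hr hα).le hq])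
  rw [decayExponent]
  set s := Real.sqrt ((r * α - l - q) ^ 2 + 4 * r * α * q)
  constructor
  · have := neg_abs_le (r * α - l - q)
    exact div_nonneg (by linarith) (by linarith)
  · field_simp
    linear_combination hs

theorem decayExponent_zero {r l α : ℝ} (hr : 0 < r) (h : l < α * r) :
    decayExponent r l α 0 = α - l / r := by
  rw [decayExponent, mul_zero, add_zero, sub_zero, Real.sqrt_sq (by linarith)]
  field_simp
  ring

theorem hasDerivAt_decayExponent {r l α : ℝ} (hr : 0 < r) (h : l < α * r) :
    HasDerivAt (decayExponent r l α) (l / (r * (α * r - l))) 0 := by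
  have h0 : 0 < α * r - l := by linarith
  have h1 : HasDerivAt (fun q : ℝ => r * α - l - q) (-1) 0 := by
    simpa using (hasDerivAt_id (0 : ℝ)).const_sub (r * α - l)
  have h2 : HasDerivAt (fun q : ℝ => (r * α - l - q) ^ 2 + 4 * r * α * q)
      (2 * (r * α - l) * (-1) + 4 * r * α) 0 := by
    convert! (h1.pow 2).add ((hasDerivAt_id (0 : ℝ)).const_mul (4 * r * α)) using 1
    simp
  have h3 := (h1.add (h2.sqrt (by
    simp only [sub_zero, mul_zero, add_zero]
    have : r * α - l ≠ 0 := by linarith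
    positivity))).div_const (2 * r)
  convert! h3 using 1
  simp only [sub_zero, mul_zero, add_zero]
  rw [Real.sqrt_sq (by linarith)]
  have : r * α - l ≠ 0 := by linarith
  have : α * r - l ≠ 0 := h0.ne'
  field_simp
  ring

theorem F_symm (a b c z : ℝ) : F a b c z = F b a c z := by
  rw [F, F, ordinaryHypergeometric, ordinaryHypergeometric, ordinaryHypergeometricSeries_symm]

/-- The combination of parameter derivatives of the hypergeometric function that is, up to the
factor `r (α r - l)`, the derivative in the killing rate. -/
noncomputable def rateDeriv (r l α z : ℝ) : ℝ :=
  (α * r + l) * Fc (α - l / r) (1 - l / r) (1 + α - l / r) z +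
    l * (Fa (α - l / r) (1 - l / r) (1 + α - l / r) z +
      Fb (α - l / r) (1 - l / r) (1 + α - l / r) z)

/-- The first two parameters move at speed k' = l/(r(αr - l)), and the third at 2k' + 1/r = (αr +
l)/(r(αr - l)). These speeds are the weights in `rateDeriv`. -/
theorem hasDerivAt_F_decayExponent {r l α z : ℝ} (hr : 0 < r) (hl : 0 < l) (h : l < α * r)
    (hz : |z| ≤ 1) :
    HasDerivAt (fun q => F (decayExponent r l α q) (decayExponent r l α q + 1 - α)
        (1 + 2 * decayExponent r l α q - α + (l + q) / r) z)
      (rateDeriv r l α z / (r * (α * r - l))) 0 := by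
  have h0 : 0 < α * r - l := by linarith
  have hlr : 0 < l / r := by positivity
  have hαl : l / r < α := by rwa [div_lt_iff₀ hr]
  have hk := hasDerivAt_decayExponent hr h
  have hk0 := decayExponent_zero hr h
  have hb := (hk.add_const 1).sub_const α
  have hc := ((hk.const_mul 2).const_add 1).sub_const α |>.add
    (((hasDerivAt_id (0 : ℝ)).const_add l).div_const r)
  have eb : decayExponent r l α 0 + 1 - α = 1 - l / r := by rw [hk0]; ring
  have ec : 1 + 2 * decayExponent r l α 0 - α + (l + id 0) / r = 1 + α - l / r := by
    rw [hk0, id, add_zero]; ring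
  have key := hasDerivAt_F_comp (z := z) hk hb hc
    (by simp only [Pi.add_apply]; rw [ec]; linarith)
    (by simp only [Pi.add_apply]; rw [ec, eb, hk0]; linarith) hz
  simp only [Pi.add_apply] at key
  rw [ec, eb, hk0] at key
  convert! key using 1
  rw [rateDeriv]
  have := h0.ne'
  field_simp
  ring

theorem F_decayExponent_zero {r l α : ℝ} (hr : 0 < r) (h : l < α * r) (z : ℝ) :
    F (decayExponent r l α 0) (decayExponent r l α 0 + 1 - α)
        (1 + 2 * decayExponent r l α 0 - α + (l + 0) / r) z =
      F (1 - l / r) (α - l / r) (1 + α - l / r) z := by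
  rw [decayExponent_zero hr h, F_symm]
  congr 1 <;> ring

/-- At killing rate zero k + l/r = α, so the third parameter is k + 1 and the special case `F_one`
suffices. -/
theorem F_one_critical {r l α : ℝ} (hr : 0 < r) (hl : 0 < l) (h : l < α * r) :
    F (1 - l / r) (α - l / r) (1 + α - l / r) 1 =
      Real.Gamma (1 + α - l / r) * Real.Gamma (l / r) / Real.Gamma α := by
  have hlr : 0 < l / r := by positivity
  have hαl : l / r < α := by rwa [div_lt_iff₀ hr]
  rw [F_symm, show 1 + α - l / r = (α - l / r) + 1 by ring,
    F_one (by linarith) (by linarith)]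
  congr 2 <;> ring_nf

/-- Product and quotient rules: the logarithm comes from y^(-k), the term without parameter
derivatives or logarithm from l/(l + q), and `rateDeriv` at y⁻¹ and at 1 from numerator and
denominator. -/
theorem hasDerivAt_laplaceSolution {r l α y : ℝ} (hr : 0 < r) (hl : 0 < l) (h : l < α * r)
    (hy : 1 ≤ y) :
    HasDerivAt (fun q => laplaceSolution r l q α (decayExponent r l α q) y)
      (-(1 / (r * (α * r - l) * Real.Gamma (l / r) ^ 2 * Real.Gamma (α - l / r + 1) ^ 2) *
        Real.Gamma α * y ^ (l / r - α) *
        (Real.Gamma α * F (1 - l / r) (α - l / r) (1 + α - l / r) y⁻¹ * rateDeriv r l α 1 +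
          1 / l * Real.Gamma (l / r) * Real.Gamma (1 + α - l / r) *
            (F (1 - l / r) (α - l / r) (1 + α - l / r) y⁻¹ *
                (r * (α * r - l) + l ^ 2 * Real.log y) - l * rateDeriv r l α y⁻¹)))) 0 := by
  have hy0 : 0 < y := by linarith
  have h0 : 0 < α * r - l := by linarith
  have hlr : 0 < l / r := by positivity
  have hαl : l / r < α := by rwa [div_lt_iff₀ hr]
  have hz : |y⁻¹| ≤ 1 := by
    rw [abs_of_pos (inv_pos.2 hy0)]
    exact inv_le_one_of_one_le₀ hy
  have hG1 : 0 < Real.Gamma (l / r) := Real.Gamma_pos_of_pos hlr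
  have hG2 : 0 < Real.Gamma α := Real.Gamma_pos_of_pos (by linarith)
  have hG3 : 0 < Real.Gamma (1 + α - l / r) := Real.Gamma_pos_of_pos (by linarith)
  have hF1 := F_one_critical hr hl h
  have hFz := F_decayExponent_zero hr h
  have hd1 : HasDerivAt (fun q : ℝ => l / (l + q)) (-(1 / l)) 0 := by
    have := (((hasDerivAt_id (0 : ℝ)).const_add l).inv (by simpa using hl.ne')).const_mul l
    convert! this using 1
    simp only [id, add_zero]
    field_simp
  have hd2 : HasDerivAt (fun q : ℝ => y ^ (-decayExponent r l α q))
      (Real.log y * (-(l / (r * (α * r - l)))) * y ^ (l / r - α)) 0 := by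
    have := (hasDerivAt_decayExponent hr h).neg.const_rpow hy0
    simp only [Pi.neg_apply] at this
    rwa [decayExponent_zero hr h, neg_sub] at this
  have hd3 := hasDerivAt_F_decayExponent hr hl h hz
  have hd4 := hasDerivAt_F_decayExponent (z := 1) hr hl h (by simp)
  have hne : F (decayExponent r l α 0) (decayExponent r l α 0 + 1 - α)
      (1 + 2 * decayExponent r l α 0 - α + (l + 0) / r) 1 ≠ 0 := by
    rw [hFz, hF1]
    positivity
  have key := (hd1.mul (hd2.mul hd3)).div hd4 hne
  convert! key using 1
  simp only [Pi.mul_apply]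
  rw [hFz, hFz, hF1, decayExponent_zero hr h, neg_sub, add_zero, div_self hl.ne',
    show α - l / r + 1 = 1 + α - l / r by ring]
  generalize Real.Gamma (l / r) = g1 at *
  generalize Real.Gamma (1 + α - l / r) = g3 at *
  generalize Real.Gamma α = g2 at *
  generalize y ^ (l / r - α) = p at *
  generalize F (1 - l / r) (α - l / r) (1 + α - l / r) y⁻¹ = w at *
  generalize rateDeriv r l α 1 = d1 at *
  generalize rateDeriv r l α y⁻¹ = d2 at *
  generalize α * r - l = e at *
  field_simp
  ring

end Household

theorem corollary1 {Ω : Type*} [MeasurableSpace Ω] (P : Measure Ω) [IsProbabilityMeasure P]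
    (r lam α xs x : ℝ) (hr : 0 < r) (hlam : 0 < lam) (hα : lam / r < α)
    (hxs : 0 < xs) (hx : xs ≤ x)
    (T Z : ℕ → Ω → ℝ) (hmodel : Household.IsLossModel P lam α T Z) :
    Integrable (Household.trappingTimeOnFinite r xs x T Z) P ∧
    HasDerivWithinAt (Household.trappingLaplace P r xs x T Z)
      (-∫ ω, Household.trappingTimeOnFinite r xs x T Z ω ∂P) (Set.Ici 0) 0 ∧
    Household.FRegularAt (α - lam / r) (1 - lam / r) (1 + α - lam / r) (x / xs)⁻¹ ∧
    Household.FRegularAt (α - lam / r) (1 - lam / r) (1 + α - lam / r) 1 ∧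
    ∫ ω, Household.trappingTimeOnFinite r xs x T Z ω ∂P =
      1 / (r * (α * r - lam) * Real.Gamma (lam / r) ^ 2 * Real.Gamma (α - lam / r + 1) ^ 2) *
        Real.Gamma α * (x / xs) ^ (lam / r - α) *
        (Real.Gamma α *
            Household.F (1 - lam / r) (α - lam / r) (1 + α - lam / r) (x / xs)⁻¹ *
            ((α * r + lam) *
                Household.Fc (α - lam / r) (1 - lam / r) (1 + α - lam / r) 1 +
              lam * (Household.Fa (α - lam / r) (1 - lam / r) (1 + α - lam / r) 1 +
                Household.Fb (α - lam / r) (1 - lam / r) (1 + α - lam / r) 1)) +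
          1 / lam * Real.Gamma (lam / r) * Real.Gamma (1 + α - lam / r) *
            (Household.F (1 - lam / r) (α - lam / r) (1 + α - lam / r) (x / xs)⁻¹ *
                (r * (α * r - lam) + lam ^ 2 * Real.log (x / xs)) -
              lam *
                ((α * r + lam) *
                    Household.Fc (α - lam / r) (1 - lam / r) (1 + α - lam / r) (x / xs)⁻¹ +
                  lam *
                    (Household.Fa (α - lam / r) (1 - lam / r) (1 + α - lam / r) (x / xs)⁻¹ +
                      Household.Fb (α - lam / r) (1 - lam / r) (1 + α - lam / r)
                        (x / xs)⁻¹)))) := by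
  have hlr : 0 < lam / r := by positivity
  have hα0 : 0 < α := by linarith
  have h : lam < α * r := by rwa [div_lt_iff₀ hr] at hα
  have hy : 1 ≤ x / xs := by rwa [le_div_iff₀ hxs, one_mul]
  have hz : |(x / xs)⁻¹| ≤ 1 := by
    rw [abs_of_pos (by positivity)]
    exact inv_le_one_of_one_le₀ hy
  have hH := Household.hasDerivAt_laplaceSolution hr hlam h hy
  have hFc := (Household.hasDerivAt_F_decayExponent (z := 1) hr hlam h (by simp)).continuousAt
  have hne : Household.F (Household.decayExponent r lam α 0)
      (Household.decayExponent r lam α 0 + 1 - α)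
      (1 + 2 * Household.decayExponent r lam α 0 - α + (lam + 0) / r) 1 ≠ 0 := by
    rw [Household.F_decayExponent_zero hr h, Household.F_one_critical hr hlam h]
    have h1 : 0 < Real.Gamma (lam / r) := Real.Gamma_pos_of_pos hlr
    have h2 : 0 < Real.Gamma α := Real.Gamma_pos_of_pos hα0
    have h3 : 0 < Real.Gamma (1 + α - lam / r) := Real.Gamma_pos_of_pos (by linarith)
    positivity
  have hcc : ContinuousAt
      (fun q => 1 + 2 * Household.decayExponent r lam α q - α + (lam + q) / r) 0 := by
    have := (Household.hasDerivAt_decayExponent hr h).continuousAt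
    fun_prop
  have hcpos : 0 < 1 + 2 * Household.decayExponent r lam α 0 - α + (lam + 0) / r := by
    rw [Household.decayExponent_zero hr h, add_zero]
    linarith
  -- For q > 0 the third parameter need not exceed the first by 1, so `F_one` need not apply to the
  -- denominator. Its nonvanishing, like positivity of the third parameter, is carried from q = 0 to
  -- small q by continuity.
  have heq : ∀ᶠ q in nhdsWithin 0 (Set.Ioi 0), ∫ ω, Household.discount q
      (Household.trappingTime r xs x (fun n => T n ω) (fun n => Z n ω)) ∂P =
      Household.laplaceSolution r lam q α (Household.decayExponent r lam α q) (x / xs) := by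
    filter_upwards [self_mem_nhdsWithin, nhdsWithin_le_nhds (hFc.eventually_ne hne),
      nhdsWithin_le_nhds (hcc.eventually (lt_mem_nhds hcpos))] with q hq hqF hqc
    have hq0 : 0 < q := hq
    obtain ⟨hk0, hk⟩ := Household.decayExponent_spec (l := lam) hr hα0 hq0.le
    exact hmodel.trappingLaplace_eq hlam hr hα0 hxs hx hq0 hk0 hk hqc hqF
  obtain ⟨hint, hder, hval⟩ := Household.integrable_toReal_of_laplace
    (hmodel.aemeasurable_trappingTime (r := r) (xs := xs) (x := x) hlam) hH heq
  -- The indicator is redundant because `toReal` sends infinity to 0.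
  have hτ : Household.trappingTimeOnFinite r xs x T Z = fun ω =>
      (Household.trappingTime r xs x (fun n => T n ω) (fun n => Z n ω)).toReal := by
    ext ω
    by_cases ht : Household.trappingTime r xs x (fun n => T n ω) (fun n => Z n ω) < ⊤
    · exact Set.indicator_of_mem (s := {ω | _ < _}) ht _
    · rw [Household.trappingTimeOnFinite, Set.indicator_of_notMem (s := {ω | _ < _}) ht,
        not_lt_top_iff.1 ht, ENNReal.toReal_top]
  rw [hτ]
  refine ⟨hint, hder, Household.fRegularAt (by linarith) (by linarith) hz,
    Household.fRegularAt (by linarith) (by linarith) (by simp), ?_⟩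
  rw [hval, neg_neg]
  rfl
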